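/- Let $S=k[x_1,\dots,x_n]$ be the $\mathbb N^n$-graded polynomial ring over a field $k$, and let $M\subseteq S$ be a monomial ideal minimally generated by monomials $m_1,\dots,m_r$. Let $\Omega$ be the full simplex on $\{1,\dots,r\}$ with its (augmented) simplicial boundary map $d$. For a face $A\subseteq\{1,\dots,r\}$ put $\operatorname{mdeg}(A)=\operatorname{lcm}(m_j : j\in A)$, with $\operatorname{mdeg}(\emptyset)=1$; the multidegree of a chain is the lcm of the multidegrees of the faces occurring in it with nonzero coefficient. Let $\mathbf T$ be the Taylor resolution of $S/M$: its multigraded basis consists of all faces $A$ of $\Omega$ (in homological degree $|A|$ and multidegree $\operatorname{mdeg}(A)$), and its differential is $A\mapsto \sum_{j\in A}(-1)^{|\{l\in A:\,l<j\}|}\,\frac{\operatorname{mdeg}(A)}{\operatorname{mdeg}(A\setminus\{j\})}\,(A\setminus\{j\})$. Complexes of multigraded free $S$-modules are finite and come with a fixed multigraded basis; a trivial complex is a direct sum of complexes $0\to S(-u)\xrightarrow{1}S(-u)\to 0$, with $u$ a monomial, placed in various homological degrees. Let $\mathbf F$ be a minimal multigraded free resolution of $S/M$. A Taylor basis of $\mathbf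 F$ is obtained as follows: choose a trivial complex $\mathcal E$ and a new multigraded basis of $\mathbf T$ with respect to which $\mathbf T$ is $\mathbf F\oplus\mathcal E$ (same degrees of the basis elements and same matrices of the differentials), and set $x_1=\dots=x_n=1$ in those new basis elements that correspond to the fixed basis of $\mathbf F$. The elements of a Taylor basis are thus chains in $\Omega$, indexed by the basis of $\mathbf F$. Let $L_M$ be the lcm-lattice of $M$, that is, the set $\{\operatorname{mdeg}(A) : A\subseteq\{1,\dots,r\}\}$ ordered by divisibility. For $\beta\in L_M$ let $A_\beta=\{j : m_j \text{ divides } \beta\}$, and for $m\in L_M$ with $m\ne 1$ let $\Delta_m$ be the simplicial complex consisting of all subsets of the sets $A_\beta$, where $\beta$ runs over the elements of $L_M$ covered by $m$ (so $\Delta_m=\{\emptyset\}$ if $m$ is one of the $m_j$). Let $b_{i,m}(S/M)$ be the multigraded Betti number, that is, the number of basis elements of homological degree $i$ and multidegree $m$ in a minimal multigraded free resolution of $S/M$. **Theorem.** Let $i\ge 1$ and let $m\in L_M$, $m\neq 1$. Let $g_1,\dots,g_p$ be all the elements of homological degree $i$ and multidegree $m$ in a Taylor basis of a minimal multigraded free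 resolution $\mathbf F$ of $S/M$. Then $d(g_1),\dots,d(g_p)$ are cycles of $\Delta_m$, and their classes $[d(g_1)],\dots,[d(g_p)]$ form a basis of $\widetilde H_{i-2}(\Delta_m;k)$. Moreover, $$b_{i,m}(S/M)=\dim_k\widetilde H_{i-2}(\Delta_m;k).$$ -/

import Mathlib

open MvPolynomial

namespace MonomialResolution

/-- A finite complex of multigraded free modules over `S = k[x_1, …, x_n]` with a fixed multigraded
basis. The finite set `B` indexes the basis of the whole complex; the basis element `b` (that is,
`Finsupp.single b 1`) has homological degree `hdeg b` and multidegree `x ^ mdeg b`, so the `i`-th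
term of the complex is `⨁_{hdeg b = i} S(-x ^ mdeg b)`. -/
structure MultigradedComplex (n : ℕ) (k : Type*) [Field k] where
  B : Type
  finite_B : Finite B
  hdeg : B → ℕ
  mdeg : B → (Fin n →₀ ℕ)
  d : (B →₀ MvPolynomial (Fin n) k) →ₗ[MvPolynomial (Fin n) k] (B →₀ MvPolynomial (Fin n) k)
  d_homogeneous : ∀ b c : B, ∀ e ∈ (d (Finsupp.single b 1) c).support,
    hdeg c + 1 = hdeg b ∧ e + mdeg c = mdeg b
  d_comp_d : d ∘ₗ d = 0

namespace MultigradedComplex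

variable {n : ℕ} {k : Type*} [Field k]

/-- The `i`-th term of the complex. -/
noncomputable def part (F : MultigradedComplex n k) (i : ℕ) :
    Submodule (MvPolynomial (Fin n) k) (F.B →₀ MvPolynomial (Fin n) k) :=
  Finsupp.supported _ _ {b | F.hdeg b = i}

/-- `f` lies in homological degree `i` and is multigraded of multidegree `x ^ a` (or `f = 0`). -/
def IsHomogeneous (F : MultigradedComplex n k) (i : ℕ) (a : Fin n →₀ ℕ)
    (f : F.B →₀ MvPolynomial (Fin n) k) : Prop :=
  ∀ b : F.B, ∀ e ∈ (f b).support, F.hdeg b = i ∧ e + F.mdeg b = a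

/-- `F` is a multigraded free resolution of `S / M`: there is a multigraded augmentation
`ε : F_0 → S / M` (extended by zero to the positive homological degrees) such that
`⋯ → F_1 → F_0 → S / M → 0` is exact. -/
def IsFreeResolution (F : MultigradedComplex n k) (M : Ideal (MvPolynomial (Fin n) k)) : Prop :=
  ∃ ε : (F.B →₀ MvPolynomial (Fin n) k) →ₗ[MvPolynomial (Fin n) k] (MvPolynomial (Fin n) k ⧸ M),
    (∀ b, F.hdeg b = 0 →
      ∃ c : k, ε (Finsupp.single b 1) = Ideal.Quotient.mk M (monomial (F.mdeg b) c)) ∧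
    (∀ b, F.hdeg b ≠ 0 → ε (Finsupp.single b 1) = 0) ∧
    Function.Surjective ε ∧
    (∀ f ∈ F.part 0, ε f = 0 ↔ ∃ g ∈ F.part 1, F.d g = f) ∧
    (∀ i, 1 ≤ i → ∀ f ∈ F.part i, F.d f = 0 ↔ ∃ g ∈ F.part (i + 1), F.d g = f)

/-- Minimality: all entries of the differential matrices lie in `(x_1, …, x_n)`. -/
def IsMinimal (F : MultigradedComplex n k) : Prop :=
  ∀ b c : F.B, F.d (Finsupp.single b 1) c ∈ Ideal.span (Set.range (X : Fin n → MvPolynomial (Fin n) k))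

def IsMinimalFreeResolution (F : MultigradedComplex n k) (M : Ideal (MvPolynomial (Fin n) k)) :
    Prop :=
  F.IsFreeResolution M ∧ F.IsMinimal

/-- A trivial complex: a direct sum of short trivial complexes `0 → S(-m) → S(-m) → 0` with the
identity map, placed in various homological degrees. -/
def IsTrivial (E : MultigradedComplex n k) : Prop :=
  ∃ (J : Type) (e : J ⊕ J ≃ E.B),
    (∀ j, E.d (Finsupp.single (e (Sum.inl j)) 1) = Finsupp.single (e (Sum.inr j)) 1) ∧
    (∀ j, E.d (Finsupp.single (e (Sum.inr j)) 1) = 0)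

end MultigradedComplex

/-- The multigraded Betti number `b_{i,x^a}(S / M)`: the number of basis elements of homological
degree `i` and multidegree `x ^ a` in a minimal free resolution of `S / M`. (This number is the same
for all minimal free resolutions; the infimum only serves to name the common value.) -/
noncomputable def bettiNumber {n : ℕ} {k : Type*} [Field k] (M : Ideal (MvPolynomial (Fin n) k))
    (i : ℕ) (a : Fin n →₀ ℕ) : ℕ :=
  sInf {p | ∃ F : MultigradedComplex n k, F.IsMinimalFreeResolution M ∧
    p = Nat.card {b : F.B // F.hdeg b = i ∧ F.mdeg b = a}}

/-- The quotient `Z / (Z ∩ B)` of subspaces of a vector space. -/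
abbrev Subquotient {k V : Type*} [Field k] [AddCommGroup V] [Module k V] (Z B : Submodule k V) :
    Type _ :=
  Z ⧸ B.submoduleOf Z

/-- The class `[z]` of an element `z` of `Z`. -/
def Subquotient.mk {k V : Type*} [Field k] [AddCommGroup V] [Module k V] {Z B : Submodule k V}
    (z : Z) : Subquotient Z B :=
  Submodule.Quotient.mk z

section Simplicial

/-- The sign of the face `A.erase j` in the boundary of the face `A`. -/
def faceSign {r : ℕ} (A : Finset (Fin r)) (j : Fin r) : ℤ :=
  (-1) ^ (A.filter (· < j)).card

variable (k : Type*) [Field k] {r : ℕ}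

/-- The boundary map of the augmented oriented chain complex of the simplex on `{1, …, r}`; chains
of all dimensions are taken together, and a face `A` has dimension `|A| - 1`. -/
noncomputable def boundary : (Finset (Fin r) →₀ k) →ₗ[k] (Finset (Fin r) →₀ k) :=
  Finsupp.linearCombination k fun A => ∑ j ∈ A, Finsupp.single (A.erase j) (faceSign A j : k)

/-- The `j`-dimensional chains of the simplicial complex `Δ` on the vertices `{1, …, r}`. A
simplicial complex is a set of faces closed under taking subsets; the empty set is a face of
dimension `-1`. -/
noncomputable def chains (Δ : LowerSet (Finset (Fin r))) (j : ℤ) : Submodule k (Finset (Fin r) →₀ k) :=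
  Finsupp.supported k k {A | A ∈ Δ ∧ (A.card : ℤ) = j + 1}

noncomputable def cycles (Δ : LowerSet (Finset (Fin r))) (j : ℤ) :
    Submodule k (Finset (Fin r) →₀ k) :=
  chains k Δ j ⊓ LinearMap.ker (boundary k)

noncomputable def boundaries (Δ : LowerSet (Finset (Fin r))) (j : ℤ) :
    Submodule k (Finset (Fin r) →₀ k) :=
  (chains k Δ (j + 1)).map (boundary k)

/-- The reduced simplicial homology `H̃_j(Δ; k)`: cycles modulo boundaries. -/
abbrev ReducedHomology (Δ : LowerSet (Finset (Fin r))) (j : ℤ) : Type _ :=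
  Subquotient (cycles k Δ j) (boundaries k Δ j)

end Simplicial

section MonomialIdeal

variable {n r : ℕ}

/-- `M` is minimally generated by the monomials `x ^ m 1, …, x ^ m r`. -/
def IsMinimallyGeneratedBy {k : Type*} [Field k] (M : Ideal (MvPolynomial (Fin n) k))
    (m : Fin r → (Fin n →₀ ℕ)) : Prop :=
  M = Ideal.span (Set.range fun j => monomial (m j) (1 : k)) ∧
  ∀ j, monomial (m j) (1 : k) ∉ Ideal.span ((fun l => monomial (m l) (1 : k)) '' {l | l ≠ j})

/-- The multidegree `lcm (m_i | i ∈ A)` of a face `A`, as an exponent vector. -/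
noncomputable def faceMdeg (m : Fin r → (Fin n →₀ ℕ)) (A : Finset (Fin r)) : Fin n →₀ ℕ :=
  A.sup m

/-- The multidegree of a chain: the lcm of the multidegrees of the faces occurring in it. -/
noncomputable def chainMdeg {k : Type*} [Field k] (m : Fin r → (Fin n →₀ ℕ)) (c : Finset (Fin r) →₀ k) :
    Fin n →₀ ℕ :=
  c.support.sup (faceMdeg m)

/-- The lcm-lattice `L_M` (exponent vectors, ordered by divisibility of monomials). -/
def lcmLattice (m : Fin r → (Fin n →₀ ℕ)) : Set (Fin n →₀ ℕ) :=
  Set.range (faceMdeg m)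

/-- The label `A_a = {i | m_i divides x ^ a}`. -/
def label (m : Fin r → (Fin n →₀ ℕ)) (a : Fin n →₀ ℕ) : Finset (Fin r) :=
  Finset.univ.filter fun j => m j ≤ a

/-- The simplicial complex `Δ_a` generated by the faces `A_β`, where `β` runs through the elements
of the lcm-lattice covered by `a`. (If `a` is an atom, it covers only the bottom element `1`, whose
label is the empty set, so `Δ_a = {∅}`.) -/
def Delta (m : Fin r → (Fin n →₀ ℕ)) (a : lcmLattice m) : LowerSet (Finset (Fin r)) :=
  lowerClosure {A | ∃ β : lcmLattice m, β ⋖ a ∧ A = label m β}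

variable (k : Type*) [Field k]

/-- The differential of the Taylor complex. -/
noncomputable def taylorD (m : Fin r → (Fin n →₀ ℕ)) :
    (Finset (Fin r) →₀ MvPolynomial (Fin n) k) →ₗ[MvPolynomial (Fin n) k]
      (Finset (Fin r) →₀ MvPolynomial (Fin n) k) :=
  Finsupp.linearCombination _ fun A => ∑ j ∈ A, Finsupp.single (A.erase j)
    (monomial (faceMdeg m A - faceMdeg m (A.erase j)) (faceSign A j : k))

theorem faceSign_mul_swap (A : Finset (Fin r)) {i j : Fin r} (hi : i ∈ A) (hj : j ∈ A)
    (hij : i ≠ j) :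
    faceSign A i * faceSign (A.erase i) j = -(faceSign A j * faceSign (A.erase j) i) := by
  wlog h : i < j generalizing i j
  · have := this hj hi hij.symm (lt_of_le_of_ne (not_lt.mp h) hij.symm)
    rw [this, neg_neg]
  have h1 : (A.erase i).filter (· < j) = (A.filter (· < j)).erase i := by
    ext x; simp only [Finset.mem_filter, Finset.mem_erase]; tauto
  have h2 : (A.erase j).filter (· < i) = A.filter (· < i) := by
    ext x; simp only [Finset.mem_filter, Finset.mem_erase]
    constructor
    · tauto
    · rintro ⟨hx, hxi⟩; exact ⟨⟨(hxi.trans h).ne, hx⟩, hxi⟩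
  have h3 : i ∈ A.filter (· < j) := by simp [hi, h]
  have h4 := Finset.card_erase_add_one h3
  unfold faceSign
  rw [h1, h2, ← h4, pow_succ]
  ring

theorem faceMdeg_mono (m : Fin r → (Fin n →₀ ℕ)) {A A' : Finset (Fin r)} (h : A ⊆ A') :
    faceMdeg m A ≤ faceMdeg m A' := Finset.sup_mono h

theorem taylorD_single (m : Fin r → (Fin n →₀ ℕ)) (A : Finset (Fin r))
    (p : MvPolynomial (Fin n) k) :
    taylorD k m (Finsupp.single A p) = ∑ j ∈ A, Finsupp.single (A.erase j)
      (p * monomial (faceMdeg m A - faceMdeg m (A.erase j)) (faceSign A j : k)) := by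
  simp [taylorD, Finsupp.linearCombination_single, Finset.smul_sum]

theorem taylorD_comp_taylorD (m : Fin r → (Fin n →₀ ℕ)) : taylorD k m ∘ₗ taylorD k m = 0 := by
  refine Finsupp.lhom_ext' fun A => LinearMap.ext_ring ?_
  simp only [LinearMap.coe_comp, Function.comp_apply, Finsupp.lsingle_apply, taylorD_single,
    map_sum, one_mul, LinearMap.zero_comp, LinearMap.zero_apply]
  have key : ∀ i ∈ A, ∀ j ∈ A.erase i,
      (Finsupp.single ((A.erase i).erase j)
        ((monomial (faceMdeg m A - faceMdeg m (A.erase i)) (faceSign A i : k)) *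
          monomial (faceMdeg m (A.erase i) - faceMdeg m ((A.erase i).erase j))
            (faceSign (A.erase i) j : k)) : Finset (Fin r) →₀ MvPolynomial (Fin n) k) =
      Finsupp.single ((A.erase i).erase j)
        (monomial (faceMdeg m A - faceMdeg m ((A.erase i).erase j))
          ((faceSign A i * faceSign (A.erase i) j : ℤ) : k)) := by
    intro i _ j _
    rw [monomial_mul, tsub_add_tsub_cancel (faceMdeg_mono m (Finset.erase_subset _ _))
      (faceMdeg_mono m (Finset.erase_subset _ _)), Int.cast_mul]
  rw [Finset.sum_congr rfl fun i hi => Finset.sum_congr rfl (key i hi), Finset.sum_sigma']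
  refine Finset.sum_involution (fun x _ => ⟨x.2, x.1⟩) ?_ ?_ ?_ ?_
  · rintro ⟨i, j⟩ h
    simp only [Finset.mem_sigma, Finset.mem_erase] at h
    obtain ⟨hi, hji, hj⟩ := h
    simp only
    rw [Finset.erase_right_comm (a := j), faceSign_mul_swap A hi hj (Ne.symm hji)]
    simp
  · rintro ⟨i, j⟩ h _ he
    simp only [Finset.mem_sigma, Finset.mem_erase] at h
    simp only [Sigma.mk.injEq] at he
    exact h.2.1 he.1
  · rintro ⟨i, j⟩ h
    simp only [Finset.mem_sigma, Finset.mem_erase] at h ⊢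
    tauto
  · rintro ⟨i, j⟩ h
    rfl

/-- The Taylor resolution, with the faces of the simplex on `{1, …, r}` as its fixed basis. -/
noncomputable abbrev taylor (m : Fin r → (Fin n →₀ ℕ)) : MultigradedComplex n k where
  B := Finset (Fin r)
  finite_B := inferInstance
  hdeg := Finset.card
  mdeg := faceMdeg m
  d := taylorD k m
  d_homogeneous := by
    classical
    intro A C e he
    rw [taylorD_single, Finsupp.finsetSum_apply] at he
    obtain ⟨j, hj, hje⟩ := Finset.mem_biUnion.mp (support_sum he)
    rw [one_mul, Finsupp.single_apply] at hje
    split_ifs at hje with hC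
    · subst hC
      have := Finset.mem_singleton.mp (support_monomial_subset hje)
      subst this
      exact ⟨Finset.card_erase_add_one hj,
        tsub_add_cancel_of_le (faceMdeg_mono m (Finset.erase_subset _ _))⟩
    · simp at hje
  d_comp_d := taylorD_comp_taylorD k m

variable {k}

/-- Dehomogenization: setting `x_1 = ⋯ = x_n = 1` turns an element of the Taylor resolution into a
chain of the simplex. -/
noncomputable def dehomogenize (f : Finset (Fin r) →₀ MvPolynomial (Fin n) k) :
    Finset (Fin r) →₀ k :=
  Finsupp.mapRange (MvPolynomial.eval fun _ => (1 : k)) (map_zero _) f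

/-- `g` is a Taylor basis of `F`: there are a trivial complex `E` and a new multigraded basis `f` of
the Taylor resolution such that, with respect to `f`, the Taylor resolution is `F ⊕ E` (the basis
elements have the degrees prescribed by `F` and `E` and the matrix of the differential is the block
diagonal matrix of the differentials of `F` and `E`), and `g` consists of the dehomogenizations of
those members of `f` that correspond to the basis of `F`. -/
def IsTaylorBasis (m : Fin r → (Fin n →₀ ℕ)) (F : MultigradedComplex n k)
    (g : F.B → (Finset (Fin r) →₀ k)) : Prop :=
  ∃ (E : MultigradedComplex n k)
    (f : Module.Basis (F.B ⊕ E.B) (MvPolynomial (Fin n) k)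
      ((taylor k m).B →₀ MvPolynomial (Fin n) k)),
    E.IsTrivial ∧
    (∀ b, (taylor k m).IsHomogeneous (F.hdeg b) (F.mdeg b) (f (Sum.inl b))) ∧
    (∀ b, (taylor k m).IsHomogeneous (E.hdeg b) (E.mdeg b) (f (Sum.inr b))) ∧
    (∀ b, (taylor k m).d (f (Sum.inl b)) =
      Finsupp.linearCombination _ (fun c => f (Sum.inl c)) (F.d (Finsupp.single b 1))) ∧
    (∀ b, (taylor k m).d (f (Sum.inr b)) =
      Finsupp.linearCombination _ (fun c => f (Sum.inr c)) (E.d (Finsupp.single b 1))) ∧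
    ∀ b, g b = dehomogenize (f (Sum.inl b))

end MonomialIdeal

end MonomialResolution

open MonomialResolution

/-! Setting all variables equal to 1 turns a multigraded complex of free modules into a complex of
vector spaces filtered by multidegree. Nothing is lost: the part of multidegree `u` is the
subcomplex spanned by the basis elements of multidegree at most `u`.

For the Taylor complex this yields the chains of the full simplex. The subcomplex `≤ a` is a full
simplex on the vertices dividing `a`, hence acyclic for `a ≠ 0`; the subcomplex `< a` consists of
the chains of `Δ_a` (`mem_Delta`). The long exact sequence of the pair therefore identifies the
reduced homology of `Δ_a` in dimension `i - 2` (faces with `i - 1` vertices) with the homology of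
the quotient `(≤ a)/(< a)` in homological degree `i`, and the isomorphism is induced by the boundary
map. For a minimal `F` the differential strictly lowers multidegrees, so the same quotient has zero
differential and its homology has as basis the basis elements of degree `(i, a)`.

It remains to compare `F` with the Taylor complex by a homotopy equivalence respecting multidegrees;
`exists_basis_reducedHomology` then runs the connecting map by hand. If a Taylor basis is given, the
equivalence is the inclusion of `F` into `F ⊕ E`, since the trivial complex `E` is contractible
(`IsTaylorBasis.exists_isHomotopyInverse`). For an arbitrary minimal resolution it comes from the
comparison theorem, carried out strand by strand (`IsStrandResolution.exists_isHomotopyInverse`). So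
every minimal resolution gives the same count; that there is one follows by cancelling invertible
entries from the Taylor resolution (`IsFreeResolution.exists_minimal`). -/

namespace MonomialResolution

/-! ### Specialization at 1 and strands of fixed multidegree -/

section Specialization

variable {σ k B B' B'' : Type*} [Field k]

/-- Setting all variables equal to `1` in the coordinates of an element of a free module. -/
noncomputable def specialize : (B →₀ MvPolynomial σ k) →ₗ[k] (B →₀ k) :=
  Finsupp.mapRange.linearMap (aeval fun _ => (1 : k)).toLinearMap

theorem specialize_apply (f : B →₀ MvPolynomial σ k) (b : B) :
    specialize f b = eval (fun _ => 1) (f b) := by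
  simp [specialize, aeval_eq_eval]

theorem specialize_smul (p : MvPolynomial σ k) (f : B →₀ MvPolynomial σ k) :
    specialize (p • f) = eval (fun _ => 1) p • specialize f := by
  ext b; simp [specialize_apply]

theorem specialize_single (b : B) (p : MvPolynomial σ k) :
    specialize (Finsupp.single b p) = Finsupp.single b (eval (fun _ => 1) p) := by
  simp [specialize, aeval_eq_eval]

/-- The `k`-linear map obtained from the matrix of an `S`-linear map by setting all variables equal
to `1`. -/
noncomputable def specializeMap
    (D : (B →₀ MvPolynomial σ k) →ₗ[MvPolynomial σ k] (B' →₀ MvPolynomial σ k)) :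
    (B →₀ k) →ₗ[k] (B' →₀ k) :=
  Finsupp.linearCombination k fun b => specialize (D (Finsupp.single b 1))

theorem specializeMap_single
    (D : (B →₀ MvPolynomial σ k) →ₗ[MvPolynomial σ k] (B' →₀ MvPolynomial σ k)) (b : B) :
    specializeMap D (Finsupp.single b 1) = specialize (D (Finsupp.single b 1)) := by
  simp [specializeMap]

theorem single_eq_smul_single_one {R : Type*} [Semiring R] (b : B) (p : R) :
    (Finsupp.single b p : B →₀ R) = p • Finsupp.single b 1 := by simp

theorem specializeMap_specialize
    (D : (B →₀ MvPolynomial σ k) →ₗ[MvPolynomial σ k] (B' →₀ MvPolynomial σ k))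
    (f : B →₀ MvPolynomial σ k) : specializeMap D (specialize f) = specialize (D f) := by
  induction f using Finsupp.induction_linear with
  | zero => simp
  | add f g hf hg => simp [hf, hg]
  | single b p =>
    rw [specialize_single, single_eq_smul_single_one b p, single_eq_smul_single_one b (eval _ p),
      map_smul, map_smul, specialize_smul, specializeMap_single]

theorem specializeMap_comp
    (D : (B →₀ MvPolynomial σ k) →ₗ[MvPolynomial σ k] (B' →₀ MvPolynomial σ k))
    (D' : (B' →₀ MvPolynomial σ k) →ₗ[MvPolynomial σ k] (B'' →₀ MvPolynomial σ k)) :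
    specializeMap (D' ∘ₗ D) = specializeMap D' ∘ₗ specializeMap D := by
  ext1 b; ext1
  simp [specializeMap_single, specializeMap_specialize]

theorem specializeMap_id :
    specializeMap (LinearMap.id : (B →₀ MvPolynomial σ k) →ₗ[MvPolynomial σ k] _) =
      LinearMap.id := by
  ext1 b; ext1
  simp [specializeMap_single, specialize_single]

/-- An `S`-linear map between free modules whose basis elements have the multidegrees `deg` and
`deg'` is multigraded of degree zero. -/
def IsMultigraded (deg : B → (σ →₀ ℕ)) (deg' : B' → (σ →₀ ℕ))
    (D : (B →₀ MvPolynomial σ k) →ₗ[MvPolynomial σ k] (B' →₀ MvPolynomial σ k)) : Prop :=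
  ∀ b c, ∀ e ∈ (D (Finsupp.single b 1) c).support, e + deg' c = deg b

variable {deg : B → (σ →₀ ℕ)} {deg' : B' → (σ →₀ ℕ)}
  {D : (B →₀ MvPolynomial σ k) →ₗ[MvPolynomial σ k] (B' →₀ MvPolynomial σ k)}

theorem eq_monomial_of_support {p : MvPolynomial σ k} {e : σ →₀ ℕ}
    (h : ∀ e' ∈ p.support, e' = e) : p = monomial e (eval (fun _ => 1) p) := by
  classical
  have h1 : p = monomial e (coeff e p) := by
    ext e'
    rw [coeff_monomial]
    split_ifs with h'
    · rw [h']
    · by_contra h2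
      exact h' (h e' (mem_support_iff.mpr h2)).symm
  rw [h1]
  simp [eval_monomial]

/-- Homogeneity leaves only one possible exponent for each matrix entry, so the entry is recovered
from its value at 1. -/
theorem IsMultigraded.apply_eq (hD : IsMultigraded deg deg' D) (b : B) (c : B') :
    D (Finsupp.single b 1) c =
      monomial (deg b - deg' c) (specializeMap D (Finsupp.single b 1) c) := by
  rw [specializeMap_single, specialize_apply]
  exact eq_monomial_of_support fun e he => by rw [← hD b c e he, add_tsub_cancel_right]

theorem support_of_specialize_ne_zero {f : B →₀ MvPolynomial σ k} {b : B}
    (h : specialize f b ≠ 0) : ∃ e, e ∈ (f b).support := by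
  rw [specialize_apply] at h
  by_contra h'
  have : f b = 0 := by
    rw [← support_eq_empty]; exact Finset.eq_empty_of_forall_notMem fun e he => h' ⟨e, he⟩
  simp [this] at h

theorem IsMultigraded.le (hD : IsMultigraded deg deg' D) {b : B} {c : B'}
    (h : specializeMap D (Finsupp.single b 1) c ≠ 0) : deg' c ≤ deg b := by
  rw [specializeMap_single] at h
  obtain ⟨e, he⟩ := support_of_specialize_ne_zero h
  rw [← hD b c e he]
  exact le_add_self

/-- The elements of multidegree `u` of the free module, written in terms of coefficients. -/
noncomputable def strandIncl (deg : B → (σ →₀ ℕ)) (u : σ →₀ ℕ) :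
    (B →₀ k) →ₗ[k] (B →₀ MvPolynomial σ k) :=
  Finsupp.linearCombination k fun b => Finsupp.single b (monomial (u - deg b) 1)

open Classical in
/-- The coefficients of the component of multidegree `u` of an element of the free module. -/
noncomputable def strandProj (deg : B → (σ →₀ ℕ)) (u : σ →₀ ℕ) :
    (B →₀ MvPolynomial σ k) →ₗ[k] (B →₀ k) :=
  Finsupp.lsum k fun b => Finsupp.lsingle b ∘ₗ
    (if deg b ≤ u then lcoeff k (u - deg b) else 0)

theorem strandIncl_single (u : σ →₀ ℕ) (b : B) (c : k) :
    strandIncl deg u (Finsupp.single b c) = Finsupp.single b (monomial (u - deg b) c) := by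
  simp [strandIncl, smul_monomial]

theorem strandIncl_apply (u : σ →₀ ℕ) (x : B →₀ k) (b : B) :
    strandIncl deg u x b = monomial (u - deg b) (x b) := by
  classical
  induction x using Finsupp.induction_linear with
  | zero => simp
  | add f g hf hg => simp [hf, hg]
  | single b' c =>
    rw [strandIncl_single, Finsupp.single_apply, Finsupp.single_apply]
    split_ifs with h
    · rw [h]
    · simp

open Classical in
theorem strandProj_apply (u : σ →₀ ℕ) (f : B →₀ MvPolynomial σ k) (b : B) :
    strandProj deg u f b = if deg b ≤ u then coeff (u - deg b) (f b) else 0 := by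
  induction f using Finsupp.induction_linear with
  | zero => simp
  | add f g hf hg => simp only [map_add, Finsupp.add_apply, hf, hg, coeff_add]; split_ifs <;> simp
  | single b' p =>
    simp only [strandProj, Finsupp.lsum_single, LinearMap.comp_apply, Finsupp.lsingle_apply,
      Finsupp.single_apply]
    by_cases h : b' = b
    · subst h; split_ifs <;> simp [lcoeff]
    · simp [h]

theorem strandProj_apply_of_eq {u e : σ →₀ ℕ} {b : B} (h : e + deg b = u)
    (f : B →₀ MvPolynomial σ k) : strandProj deg u f b = coeff e (f b) := by
  rw [strandProj_apply, if_pos (h ▸ le_add_self), ← h, add_tsub_cancel_right]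

theorem strandProj_apply_of_not_le {u : σ →₀ ℕ} {b : B} (h : ¬ deg b ≤ u)
    (f : B →₀ MvPolynomial σ k) : strandProj deg u f b = 0 := by
  rw [strandProj_apply, if_neg h]

theorem strandProj_strandIncl {u : σ →₀ ℕ} {x : B →₀ k} (hx : ∀ b, x b ≠ 0 → deg b ≤ u) :
    strandProj deg u (strandIncl deg u x) = x := by
  classical
  ext b
  by_cases h : deg b ≤ u
  · rw [strandProj_apply_of_eq (tsub_add_cancel_of_le h), strandIncl_apply, coeff_monomial,
      if_pos rfl]
  · rw [strandProj_apply_of_not_le h]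
    by_contra h'
    exact h (hx b (Ne.symm h'))

open Classical in
theorem strandProj_single_monomial (u e : σ →₀ ℕ) (b : B) (c : k) :
    strandProj deg u (Finsupp.single b (monomial e c)) =
      (if e + deg b = u then c else 0) • Finsupp.single b (1 : k) := by
  ext b'
  rw [strandProj_apply, Finsupp.smul_apply, Finsupp.single_apply, Finsupp.single_apply]
  by_cases hb : b = b'
  · subst hb
    simp only [if_pos, coeff_monomial, smul_eq_mul, mul_one]
    by_cases h : deg b ≤ u
    · simp only [if_pos h, eq_tsub_iff_add_eq_of_le h]
    · rw [if_neg h, if_neg]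
      rintro rfl
      exact h le_add_self
  · simp [hb]

theorem IsMultigraded.strandProj_map (hD : IsMultigraded deg deg' D) (u : σ →₀ ℕ)
    (f : B →₀ MvPolynomial σ k) :
    strandProj deg' u (D f) = specializeMap D (strandProj deg u f) := by
  classical
  induction f using Finsupp.induction_linear with
  | zero => simp
  | add f g hf hg => simp [hf, hg]
  | single b p =>
    induction p using MvPolynomial.induction_on' with
    | add p q hp hq => simp only [Finsupp.single_add, map_add, hp, hq]
    | monomial e c =>
      rw [strandProj_single_monomial, map_smul, single_eq_smul_single_one b (monomial e c), map_smul]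
      ext c'
      rw [strandProj_apply, Finsupp.smul_apply, Finsupp.smul_apply, smul_eq_mul, smul_eq_mul,
        hD.apply_eq, monomial_mul, coeff_monomial]
      by_cases h0 : specializeMap D (Finsupp.single b 1) c' = 0
      · simp [h0]
      · have hle := hD.le h0
        -- Subtraction of exponents is truncated, so the condition `deg' c' ≤ u` has to be carried
        -- along with the equation.
        have h2 : (e + (deg b - deg' c') = u - deg' c' ∧ deg' c' ≤ u) ↔ e + deg b = u := by
          constructor
          · rintro ⟨h, h'⟩
            rw [← tsub_add_cancel_of_le h', ← h, add_assoc, tsub_add_cancel_of_le hle]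
          · rintro rfl
            exact ⟨by rw [add_tsub_assoc_of_le hle], hle.trans le_add_self⟩
        by_cases h3 : e + deg b = u
        · rw [if_pos h3, if_pos (h2.2 h3).2, if_pos (h2.2 h3).1]
        · rw [if_neg h3, zero_mul]
          split_ifs with h4 h5
          · exact (h3 (h2.1 ⟨h5, h4⟩)).elim
          · rfl
          · rfl

/-- The bound on the support of `x` is essential: for `deg b` not below `u`, truncated subtraction
would put the coordinate at `b` in a multidegree other than `u`. -/
theorem IsMultigraded.map_strandIncl (hD : IsMultigraded deg deg' D) {u : σ →₀ ℕ} {x : B →₀ k}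
    (hx : ∀ b, x b ≠ 0 → deg b ≤ u) :
    D (strandIncl deg u x) = strandIncl deg' u (specializeMap D x) := by
  classical
  have key : ∀ s : Finset B, (∀ b ∈ s, deg b ≤ u) → ∀ y : B → k,
      D (strandIncl deg u (∑ b ∈ s, y b • Finsupp.single b 1)) =
        strandIncl deg' u (specializeMap D (∑ b ∈ s, y b • Finsupp.single b 1)) := by
    intro s hs y
    simp only [map_sum, map_smul, LinearMap.map_smul_of_tower]
    refine Finset.sum_congr rfl fun b hb => ?_
    congr 1
    rw [strandIncl_single, single_eq_smul_single_one, map_smul]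
    ext1 c
    rw [strandIncl_apply, Finsupp.smul_apply, hD.apply_eq, smul_eq_mul, monomial_mul, one_mul]
    by_cases h0 : specializeMap D (Finsupp.single b 1) c = 0
    · simp [h0]
    · rw [tsub_add_tsub_cancel (hs b hb) (hD.le h0)]
  have hx' : x = ∑ b ∈ x.support, x b • Finsupp.single b 1 := by
    conv_lhs => rw [← Finsupp.sum_single x]
    simp [Finsupp.sum]
  rw [hx']
  exact key _ (fun b hb => hx b (Finsupp.mem_support_iff.mp hb)) _

theorem exists_eq_sum_strandIncl (deg : B → (σ →₀ ℕ)) (f : B →₀ MvPolynomial σ k) :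
    ∃ U : Finset (σ →₀ ℕ), f = ∑ u ∈ U, strandIncl deg u (strandProj deg u f) := by
  classical
  -- All multidegrees occurring in `f`.
  refine ⟨f.support.biUnion fun b => (f b).support.image (· + deg b), ?_⟩
  ext b e
  have hcoeff : ∀ u, coeff e (strandIncl deg u (strandProj deg u f) b) =
      if u = e + deg b then coeff e (f b) else 0 := by
    intro u
    rw [strandIncl_apply, coeff_monomial]
    by_cases h : u = e + deg b
    · rw [if_pos h, if_pos (by rw [h, add_tsub_cancel_right]), strandProj_apply_of_eq h.symm]
    · rw [if_neg h]
      split_ifs with h'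
      · refine strandProj_apply_of_not_le (fun hle => h ?_) _
        rw [← h', tsub_add_cancel_of_le hle]
      · rfl
  rw [Finsupp.finsetSum_apply, coeff_sum, Finset.sum_congr rfl fun u _ => hcoeff u,
    Finset.sum_ite_eq']
  split_ifs with h
  · rfl
  · by_contra h0
    refine h (Finset.mem_biUnion.mpr ⟨b, ?_, Finset.mem_image.mpr ⟨e, mem_support_iff.mpr h0, rfl⟩⟩)
    rw [Finsupp.mem_support_iff]
    rintro h1
    simp [h1] at h0

end Specialization
end MonomialResolution

/-! ### Filtered maps, minimality and the connecting map -/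

namespace MonomialResolution
namespace MultigradedComplex

variable {n : ℕ} {k : Type*} [Field k]

theorem isMultigraded_d (F : MultigradedComplex n k) : IsMultigraded F.mdeg F.mdeg F.d :=
  fun b c e he => (F.d_homogeneous b c e he).2

/-- The differential with all variables set equal to `1`. -/
noncomputable def dBar (F : MultigradedComplex n k) : (F.B →₀ k) →ₗ[k] (F.B →₀ k) :=
  specializeMap F.d

theorem dBar_dBar (F : MultigradedComplex n k) (x : F.B →₀ k) : F.dBar (F.dBar x) = 0 := by
  have h : F.dBar ∘ₗ F.dBar = 0 := by
    rw [dBar, ← specializeMap_comp, F.d_comp_d]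
    ext1 b; ext1
    simp [specializeMap_single]
  exact LinearMap.congr_fun h x

/-- The span of the basis elements of homological degree `i` with multidegree in `U`. -/
noncomputable def piece (F : MultigradedComplex n k) (i : ℤ) (U : Set (Fin n →₀ ℕ)) :
    Submodule k (F.B →₀ k) :=
  Finsupp.supported k k {b | (F.hdeg b : ℤ) = i ∧ F.mdeg b ∈ U}

variable {F G H : MultigradedComplex n k}

theorem mem_piece {i : ℤ} {U : Set (Fin n →₀ ℕ)} {x : F.B →₀ k} :
    x ∈ F.piece i U ↔ ∀ b, x b ≠ 0 → (F.hdeg b : ℤ) = i ∧ F.mdeg b ∈ U := by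
  rw [piece, Finsupp.mem_supported']
  exact forall_congr' fun b => not_imp_comm

theorem single_mem_piece {i : ℤ} {U : Set (Fin n →₀ ℕ)} {b : F.B} (hi : (F.hdeg b : ℤ) = i)
    (hU : F.mdeg b ∈ U) (c : k) : Finsupp.single b c ∈ F.piece i U :=
  Finsupp.single_mem_supported k c ⟨hi, hU⟩

theorem piece_mono {i : ℤ} {U V : Set (Fin n →₀ ℕ)} (h : U ⊆ V) : F.piece i U ≤ F.piece i V :=
  Finsupp.supported_mono fun _ hb => ⟨hb.1, h hb.2⟩

theorem piece_eq_span (i : ℤ) (U : Set (Fin n →₀ ℕ)) : F.piece i U =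
    Submodule.span k ((fun b => Finsupp.single b 1) '' {b | (F.hdeg b : ℤ) = i ∧ F.mdeg b ∈ U}) :=
  Finsupp.supported_eq_span_single k _

theorem exists_add_of_mem_piece_Iic {i : ℤ} {a : Fin n →₀ ℕ} {z : F.B →₀ k}
    (hz : z ∈ F.piece i (Set.Iic a)) :
    ∃ x ∈ F.piece i {a}, ∃ y ∈ F.piece i (Set.Iio a), x + y = z := by
  rw [← Submodule.mem_sup, piece, piece, ← Finsupp.supported_union]
  refine Finsupp.supported_mono (fun b hb => ?_) hz
  rcases eq_or_lt_of_le (show F.mdeg b ≤ a from hb.2) with h | h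
  · exact Or.inl ⟨hb.1, h⟩
  · exact Or.inr ⟨hb.1, h⟩

/-- With `W = ⊥` this proves identities between linear maps that are only known on one piece. -/
theorem map_mem_of_single_mem {V : Type*} [AddCommGroup V] [Module k V] {i : ℤ}
    {U : Set (Fin n →₀ ℕ)} {φ : (F.B →₀ k) →ₗ[k] V} {W : Submodule k V}
    (h : ∀ b, (F.hdeg b : ℤ) = i → F.mdeg b ∈ U → φ (Finsupp.single b 1) ∈ W) {x : F.B →₀ k}
    (hx : x ∈ F.piece i U) : φ x ∈ W := by
  have : F.piece i U ≤ W.comap φ := by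
    rw [piece_eq_span, Submodule.span_le]
    rintro _ ⟨b, hb, rfl⟩
    exact h b hb.1 hb.2
  exact this hx

/-- `φ` raises homological degrees by `s` and does not increase multidegrees. -/
def IsFiltered (F G : MultigradedComplex n k) (s : ℤ) (φ : (F.B →₀ k) →ₗ[k] (G.B →₀ k)) : Prop :=
  ∀ b, φ (Finsupp.single b 1) ∈ G.piece (F.hdeg b + s) (Set.Iic (F.mdeg b))

theorem IsFiltered.map_mem {s : ℤ} {φ : (F.B →₀ k) →ₗ[k] (G.B →₀ k)} (hφ : IsFiltered F G s φ)
    {i j : ℤ} (hj : i + s = j) {U : Set (Fin n →₀ ℕ)} (hU : IsLowerSet U) {x : F.B →₀ k}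
    (hx : x ∈ F.piece i U) : φ x ∈ G.piece j U := by
  refine map_mem_of_single_mem (fun b hb hbU => ?_) hx
  rw [← hj, ← hb]
  exact piece_mono (fun c hc => hU hc hbU) (hφ b)

theorem IsFiltered.comp {s t u : ℤ} {φ : (F.B →₀ k) →ₗ[k] (G.B →₀ k)}
    {ψ : (G.B →₀ k) →ₗ[k] (H.B →₀ k)} (hψ : IsFiltered G H t ψ) (hφ : IsFiltered F G s φ)
    (hu : s + t = u) : IsFiltered F H u (ψ ∘ₗ φ) := fun b =>
  hψ.map_mem (by rw [← hu, add_assoc]) (isLowerSet_Iic _) (hφ b)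

theorem isFiltered_id : IsFiltered F F 0 LinearMap.id := fun b =>
  single_mem_piece (by simp) (by simp) _

theorem IsFiltered.sub {s : ℤ} {φ ψ : (F.B →₀ k) →ₗ[k] (G.B →₀ k)} (hφ : IsFiltered F G s φ)
    (hψ : IsFiltered F G s ψ) : IsFiltered F G s (φ - ψ) := fun b => sub_mem (hφ b) (hψ b)

theorem IsFiltered.neg {s : ℤ} {φ : (F.B →₀ k) →ₗ[k] (G.B →₀ k)} (hφ : IsFiltered F G s φ) :
    IsFiltered F G s (-φ) := fun b => neg_mem (hφ b)

theorem d_single_apply (F : MultigradedComplex n k) (b c : F.B) :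
    F.d (Finsupp.single b 1) c =
      monomial (F.mdeg b - F.mdeg c) (F.dBar (Finsupp.single b 1) c) :=
  F.isMultigraded_d.apply_eq b c

theorem degrees_of_dBar_ne_zero {b c : F.B} (h : F.dBar (Finsupp.single b 1) c ≠ 0) :
    F.hdeg c + 1 = F.hdeg b ∧ F.mdeg c ≤ F.mdeg b := by
  refine ⟨?_, F.isMultigraded_d.le h⟩
  rw [dBar, specializeMap_single] at h
  obtain ⟨e, he⟩ := support_of_specialize_ne_zero h
  exact (F.d_homogeneous b c e he).1

theorem isFiltered_dBar (F : MultigradedComplex n k) : IsFiltered F F (-1) F.dBar := fun b => by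
  rw [mem_piece]
  intro c hc
  obtain ⟨h1, h2⟩ := degrees_of_dBar_ne_zero hc
  exact ⟨by omega, h2⟩

/-- Between equal multidegrees the entry is a constant, and evaluation at 0 shows that the only
constant in the ideal of the variables is 0. -/
theorem IsMinimal.mdeg_lt (hF : F.IsMinimal) {b c : F.B}
    (h : F.dBar (Finsupp.single b 1) c ≠ 0) : F.mdeg c < F.mdeg b := by
  refine lt_of_le_of_ne (degrees_of_dBar_ne_zero h).2 fun heq => h ?_
  have h1 := hF b c
  rw [d_single_apply, heq, tsub_self] at h1
  have h2 : Ideal.span (Set.range (X : Fin n → MvPolynomial (Fin n) k)) ≤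
      RingHom.ker (eval fun _ => (0 : k)) := by
    rw [Ideal.span_le]
    rintro _ ⟨j, rfl⟩
    simp
  simpa [eval_monomial] using h2 h1

theorem IsMinimal.dBar_mem (hF : F.IsMinimal) {a : Fin n →₀ ℕ} {i j : ℤ} (hj : i - 1 = j)
    {x : F.B →₀ k} (hx : x ∈ F.piece i (Set.Iic a)) : F.dBar x ∈ F.piece j (Set.Iio a) := by
  refine map_mem_of_single_mem (fun b hb hba => mem_piece.mpr fun c hc => ?_) hx
  have := (degrees_of_dBar_ne_zero hc).1
  exact ⟨by omega, (hF.mdeg_lt hc).trans_le hba⟩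

/-- The strand of multidegree `a` is exact. -/
def IsExactAt (F : MultigradedComplex n k) (a : Fin n →₀ ℕ) : Prop :=
  ∀ (i : ℤ), ∀ x ∈ F.piece i (Set.Iic a), F.dBar x = 0 →
    ∃ y ∈ F.piece (i + 1) (Set.Iic a), F.dBar y = x

/-- `φ` and `ψ` are mutually inverse up to the homotopies `hF` and `hG`, all maps being
compatible with multidegrees. -/
structure IsHomotopyInverse (F G : MultigradedComplex n k) (φ : (F.B →₀ k) →ₗ[k] (G.B →₀ k))
    (ψ : (G.B →₀ k) →ₗ[k] (F.B →₀ k)) (hF : (F.B →₀ k) →ₗ[k] (F.B →₀ k))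
    (hG : (G.B →₀ k) →ₗ[k] (G.B →₀ k)) : Prop where
  filtered_φ : IsFiltered F G 0 φ
  filtered_ψ : IsFiltered G F 0 ψ
  filtered_hF : IsFiltered F F 1 hF
  filtered_hG : IsFiltered G G 1 hG
  φ_comm : ∀ x, φ (F.dBar x) = G.dBar (φ x)
  ψ_comm : ∀ x, ψ (G.dBar x) = F.dBar (ψ x)
  homotopy_F : ∀ x, ψ (φ x) = x + F.dBar (hF x) + hF (F.dBar x)
  homotopy_G : ∀ x, φ (ψ x) = x + G.dBar (hG x) + hG (G.dBar x)

section

variable {φ : (F.B →₀ k) →ₗ[k] (G.B →₀ k)} {ψ : (G.B →₀ k) →ₗ[k] (F.B →₀ k)}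
  {hF : (F.B →₀ k) →ₗ[k] (F.B →₀ k)} {hG : (G.B →₀ k) →ₗ[k] (G.B →₀ k)}

/-- Injectivity of the connecting map. The cycle `φ x - y` bounds some `z` in the exact strand;
applying `ψ` and the homotopy expresses `x` through terms of multidegree below `a`, while `x` is
concentrated in multidegree `a`. -/
theorem IsHomotopyInverse.eq_zero_of_dBar_eq (h : IsHomotopyInverse F G φ ψ hF hG)
    (hmin : F.IsMinimal) {a : Fin n →₀ ℕ} (hex : G.IsExactAt a) {i : ℤ} {x : F.B →₀ k}
    (hx : x ∈ F.piece i {a}) {y : G.B →₀ k} (hy : y ∈ G.piece i (Set.Iio a))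
    (hxy : G.dBar (φ x) = G.dBar y) : x = 0 := by
  have hx' : x ∈ F.piece i (Set.Iic a) := piece_mono (by simp) hx
  have hIio : (Set.Iio a) ⊆ Set.Iic a := Set.Iio_subset_Iic_self
  obtain ⟨z, hz, hdz⟩ := hex i (φ x - y)
    (sub_mem (h.filtered_φ.map_mem (by simp) (isLowerSet_Iic a) hx') (piece_mono hIio hy))
    (by rw [map_sub, hxy, sub_self])
  have h1 := congrArg ψ hdz
  rw [h.ψ_comm, map_sub, h.homotopy_F] at h1
  have h2 : x = ψ y + F.dBar (ψ z) - F.dBar (hF x) - hF (F.dBar x) := by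
    rw [h1]; abel
  have h3 : x ∈ F.piece i (Set.Iio a) := by
    rw [h2]
    -- The first term is below `a` because `y` is; in the other three a differential of `F` occurs,
    -- and minimality makes it drop below `a`.
    refine sub_mem (sub_mem (add_mem ?_ ?_) ?_) ?_
    · exact h.filtered_ψ.map_mem (by simp) (isLowerSet_Iio a) hy
    · exact hmin.dBar_mem (by ring) (h.filtered_ψ.map_mem rfl (isLowerSet_Iic a) hz)
    · exact hmin.dBar_mem (by ring) (h.filtered_hF.map_mem rfl (isLowerSet_Iic a) hx')
    · exact h.filtered_hF.map_mem (by ring) (isLowerSet_Iio a) (hmin.dBar_mem rfl hx')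
  ext b
  by_contra hb
  exact ((mem_piece.mp h3 b hb).2).ne (mem_piece.mp hx b hb).2

/-- Surjectivity of the connecting map: write `w` as the boundary of `z` in the strand `≤ a` and let
`x` be the part of `ψ z` in multidegree exactly `a`. The rest of `ψ z` and the homotopy term
contribute only boundaries of chains below `a`. -/
theorem IsHomotopyInverse.exists_of_cycle (h : IsHomotopyInverse F G φ ψ hF hG)
    {a : Fin n →₀ ℕ} (hex : G.IsExactAt a) {i : ℤ} {w : G.B →₀ k}
    (hw : w ∈ G.piece (i - 1) (Set.Iio a)) (hdw : G.dBar w = 0) :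
    ∃ x ∈ F.piece i {a}, ∃ y ∈ G.piece i (Set.Iio a), G.dBar (φ x) + G.dBar y = w := by
  obtain ⟨z, hz, hdz⟩ := hex _ w (piece_mono Set.Iio_subset_Iic_self hw) hdw
  rw [sub_add_cancel] at hz
  obtain ⟨x, hx, x', hx', hxx⟩ := exists_add_of_mem_piece_Iic
    (h.filtered_ψ.map_mem (add_zero i) (isLowerSet_Iic a) hz)
  refine ⟨x, hx, φ x' - hG w, sub_mem (h.filtered_φ.map_mem (add_zero i) (isLowerSet_Iio a) hx')
    (h.filtered_hG.map_mem (sub_add_cancel i 1) (isLowerSet_Iio a) hw), ?_⟩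
  have h1 := congrArg G.dBar (h.homotopy_G z)
  rw [← hxx, hdz, map_add, map_add, map_add, map_add, G.dBar_dBar, hdz] at h1
  rw [map_sub, ← add_sub_assoc, h1]
  abel

end

end MultigradedComplex
end MonomialResolution

/-! ### The Taylor complex and the homology of `Δ_a` -/

namespace MonomialResolution
open MultigradedComplex

variable {n r : ℕ} {k : Type*} [Field k] {m : Fin r → (Fin n →₀ ℕ)}

theorem boundary_single (A : Finset (Fin r)) : boundary k (Finsupp.single A 1) =
    ∑ j ∈ A, Finsupp.single (A.erase j) (faceSign A j : k) := by
  simp [boundary]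

theorem dBar_taylor : (taylor k m).dBar = boundary k := by
  ext1 A; ext1
  simp only [LinearMap.comp_apply, Finsupp.lsingle_apply]
  rw [dBar, specializeMap_single, boundary_single]
  simp [taylorD_single, specialize_single, eval_monomial]

/-- The lcm-lattice is finite, so every element below `a` lies below one covered by `a`. This makes
`Δ_a` the part of the simplex of multidegree strictly less than `a`. -/
theorem mem_Delta {a : lcmLattice m} {A : Finset (Fin r)} :
    A ∈ Delta m a ↔ faceMdeg m A < a := by
  have hfin : Finite (lcmLattice m) := Set.finite_range _
  rw [Delta, mem_lowerClosure]
  constructor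
  · rintro ⟨_, ⟨β, hβ, rfl⟩, hA⟩
    refine lt_of_le_of_lt (Finset.sup_le fun j hj => ?_) hβ.lt
    exact (Finset.mem_filter.mp (hA hj)).2
  · intro h
    obtain ⟨β, h1, h2⟩ := exists_le_covBy_of_lt (a := (⟨faceMdeg m A, A, rfl⟩ : lcmLattice m)) h
    exact ⟨_, ⟨β, h2, rfl⟩, fun j hj => Finset.mem_filter.mpr
      ⟨Finset.mem_univ _, le_trans (Finset.le_sup (f := m) hj) h1⟩⟩

theorem chains_Delta (a : lcmLattice m) {i j : ℤ} (h : j + 1 = i) :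
    chains k (Delta m a) j = (taylor k m).piece i (Set.Iio a) := by
  subst h
  unfold chains piece
  congr 1
  ext A
  simp [mem_Delta, and_comm]

theorem faceSign_mul_self (A : Finset (Fin r)) (j : Fin r) : faceSign A j * faceSign A j = 1 := by
  rw [faceSign, ← mul_pow]; simp

/-- The contraction of the simplex onto its vertex `v`. -/
noncomputable def coneHomotopy (k : Type*) [Field k] (v : Fin r) :
    (Finset (Fin r) →₀ k) →ₗ[k] (Finset (Fin r) →₀ k) :=
  Finsupp.linearCombination k fun A =>
    if v ∈ A then 0 else Finsupp.single (insert v A) (faceSign (insert v A) v : k)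

theorem coneHomotopy_single_of_mem {v : Fin r} {A : Finset (Fin r)} (h : v ∈ A) (c : k) :
    coneHomotopy k v (Finsupp.single A c) = 0 := by
  simp [coneHomotopy, h]

theorem coneHomotopy_single_of_notMem {v : Fin r} {A : Finset (Fin r)} (h : v ∉ A) (c : k) :
    coneHomotopy k v (Finsupp.single A c) =
      c • Finsupp.single (insert v A) (faceSign (insert v A) v : k) := by
  simp [coneHomotopy, h]

/-- If `v ∈ A`, only the boundary term omitting `v` survives the cone and it restores `A`. If `v ∉
A`, omitting `v` from the cone restores `A`, and the remaining terms cancel in pairs by the sign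
rule. -/
theorem boundary_coneHomotopy (v : Fin r) (x : Finset (Fin r) →₀ k) :
    boundary k (coneHomotopy k v x) + coneHomotopy k v (boundary k x) = x := by
  suffices h : boundary k ∘ₗ coneHomotopy k v + coneHomotopy k v ∘ₗ boundary k = LinearMap.id from
    LinearMap.congr_fun h x
  ext1 A; ext1
  simp only [LinearMap.comp_apply, LinearMap.add_apply, Finsupp.lsingle_apply, LinearMap.id_apply]
  rw [boundary_single, map_sum]
  by_cases hv : v ∈ A
  · rw [coneHomotopy_single_of_mem hv, map_zero, zero_add, Finset.sum_eq_single_of_mem v hv]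
    · rw [coneHomotopy_single_of_notMem (Finset.notMem_erase v A), Finset.insert_erase hv,
        Finsupp.smul_single, smul_eq_mul, ← Int.cast_mul, faceSign_mul_self, Int.cast_one]
    · intro j _ hj
      exact coneHomotopy_single_of_mem (Finset.mem_erase.mpr ⟨hj.symm, hv⟩) _
  · rw [coneHomotopy_single_of_notMem hv, one_smul,
      single_eq_smul_single_one _ ((faceSign (insert v A) v : ℤ) : k), map_smul, boundary_single,
      Finset.sum_insert hv, smul_add, Finset.erase_insert hv, Finsupp.smul_single, smul_eq_mul,
      ← Int.cast_mul, faceSign_mul_self, Int.cast_one, add_assoc, Finset.smul_sum,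
      ← Finset.sum_add_distrib, Finset.sum_eq_zero, add_zero]
    intro j hj
    have hjv : v ≠ j := fun h => hv (h ▸ hj)
    have hsign := faceSign_mul_swap (insert v A) (Finset.mem_insert_self v A)
      (Finset.mem_insert_of_mem hj) hjv
    rw [Finset.erase_insert hv] at hsign
    rw [coneHomotopy_single_of_notMem (fun h => hv (Finset.mem_of_mem_erase h)),
      ← Finset.erase_insert_of_ne hjv, Finsupp.smul_single, Finsupp.smul_single, smul_eq_mul,
      smul_eq_mul, ← Finsupp.single_add, ← Int.cast_mul, ← Int.cast_mul, ← Int.cast_add]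
    have h1 := faceSign_mul_self (insert v A) j
    have h2 := faceSign_mul_self (insert v A) v
    have h3 := faceSign_mul_self A j
    -- All signs square to 1, so multiplying the swap relation by two of them moves these to the
    -- other side.
    have h4 : faceSign (insert v A) v * faceSign (insert v A) j +
        faceSign A j * faceSign ((insert v A).erase j) v = 0 := by
      linear_combination (faceSign (insert v A) j * faceSign A j) * hsign
        - faceSign (insert v A) v * faceSign (insert v A) j * h3
        - faceSign A j * faceSign ((insert v A).erase j) v * h1
    rw [h4]; simp

theorem isFiltered_coneHomotopy {v : Fin r} {u : Fin n →₀ ℕ} (hv : m v ≤ u) {i : ℤ}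
    {x : Finset (Fin r) →₀ k} (hx : x ∈ (taylor k m).piece i (Set.Iic u)) :
    coneHomotopy k v x ∈ (taylor k m).piece (i + 1) (Set.Iic u) := by
  refine map_mem_of_single_mem (fun A hA hAu => ?_) hx
  by_cases h : v ∈ A
  · rw [coneHomotopy_single_of_mem h]; exact zero_mem _
  · rw [coneHomotopy_single_of_notMem h]
    refine Submodule.smul_mem _ _ (single_mem_piece ?_ ?_ _)
    · rw [← hA]
      simp [Finset.card_insert_of_notMem h]
    · change Finset.sup (insert v A) m ≤ u
      rw [Finset.sup_insert]
      exact sup_le hv hAu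

/-- Coning with a vertex `v` such that `m v ≤ u` does not leave the strand `≤ u`. -/
theorem isExactAt_taylor {v : Fin r} {u : Fin n →₀ ℕ} (hv : m v ≤ u) :
    (taylor k m).IsExactAt u := by
  intro i x hx hdx
  refine ⟨coneHomotopy k v x, isFiltered_coneHomotopy hv hx, ?_⟩
  have := boundary_coneHomotopy v x
  rw [dBar_taylor] at hdx ⊢
  rwa [hdx, map_zero, add_zero] at this

theorem exists_le_of_mem_lcmLattice {a : lcmLattice m} (ha : (a : Fin n →₀ ℕ) ≠ 0) :
    ∃ v, m v ≤ a := by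
  obtain ⟨_, A, rfl⟩ := a
  rcases A.eq_empty_or_nonempty with rfl | ⟨v, hv⟩
  · exact (ha rfl).elim
  · exact ⟨v, Finset.le_sup (f := m) hv⟩

/-- The connecting map made explicit. The predicate `p` is left free so that the index type can be
phrased either with the multidegrees of `F` or with those of the chains of a Taylor basis. -/
theorem exists_basis_reducedHomology {F : MultigradedComplex n k} (hmin : F.IsMinimal)
    {φ : (F.B →₀ k) →ₗ[k] (Finset (Fin r) →₀ k)} {ψ : (Finset (Fin r) →₀ k) →ₗ[k] (F.B →₀ k)}
    {hF : (F.B →₀ k) →ₗ[k] (F.B →₀ k)}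
    {hT : (Finset (Fin r) →₀ k) →ₗ[k] (Finset (Fin r) →₀ k)}
    (h : IsHomotopyInverse F (taylor k m) φ ψ hF hT) (i : ℕ) (a : lcmLattice m)
    (ha : (a : Fin n →₀ ℕ) ≠ 0) (p : F.B → Prop)
    (hp : ∀ b, p b ↔ F.hdeg b = i ∧ F.mdeg b = a) :
    ∃ β : Module.Basis {b // p b} k (ReducedHomology k (Delta m a) ((i : ℤ) - 2)),
      ∀ b : {b // p b},
        ∃ hb : boundary k (φ (Finsupp.single b.1 1)) ∈ cycles k (Delta m a) ((i : ℤ) - 2),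
        β b = Subquotient.mk ⟨boundary k (φ (Finsupp.single b.1 1)), hb⟩ := by
  obtain ⟨v, hv⟩ := exists_le_of_mem_lcmLattice ha
  have hex : (taylor k m).IsExactAt a := isExactAt_taylor hv
  have hc1 : chains k (Delta m a) ((i : ℤ) - 2) = (taylor k m).piece (i - 1) (Set.Iio a) :=
    chains_Delta a (by ring)
  have hc2 : chains k (Delta m a) ((i : ℤ) - 2 + 1) = (taylor k m).piece i (Set.Iio a) :=
    chains_Delta a (by ring)
  have hpiece : ∀ b, p b → Finsupp.single b 1 ∈ F.piece i {(a : Fin n →₀ ℕ)} := fun b hb =>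
    single_mem_piece (by rw [((hp b).1 hb).1]) ((hp b).1 hb).2 _
  have hdd : ∀ x : Finset (Fin r) →₀ k, boundary k (boundary k x) = 0 := fun x => by
    rw [← dBar_taylor (m := m)]
    exact (taylor k m).dBar_dBar x
  have hcyc : ∀ b, p b →
      boundary k (φ (Finsupp.single b 1)) ∈ cycles k (Delta m a) ((i : ℤ) - 2) := by
    intro b hb
    refine ⟨?_, hdd _⟩
    rw [SetLike.mem_coe, hc1]
    -- The boundary of `φ b` is `φ` of the differential of `b`, which minimality puts strictly below
    -- `a`.
    have := h.filtered_φ.map_mem (add_zero _) (isLowerSet_Iio (a : Fin n →₀ ℕ))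
      (hmin.dBar_mem rfl (piece_mono (by simp) (hpiece b hb)))
    rwa [h.φ_comm, dBar_taylor] at this
  let z : {b // p b} → cycles k (Delta m a) ((i : ℤ) - 2) := fun b => ⟨_, hcyc b.1 b.2⟩
  let q : cycles k (Delta m a) ((i : ℤ) - 2) →ₗ[k] ReducedHomology k (Delta m a) ((i : ℤ) - 2) :=
    Submodule.mkQ _
  have hli : LinearIndependent k (q ∘ z) := by
    rw [linearIndependent_iff]
    intro l hl
    have hz : ((Finsupp.linearCombination k z l : cycles k (Delta m a) ((i : ℤ) - 2)) :
        Finset (Fin r) →₀ k) = boundary k (φ (l.mapDomain Subtype.val)) := by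
      have : (Submodule.subtype _ ∘ₗ Finsupp.linearCombination k z) =
          boundary k ∘ₗ φ ∘ₗ Finsupp.lmapDomain k k Subtype.val := by
        ext1 b; ext1
        simp [z]
      exact LinearMap.congr_fun this l
    rw [← Finsupp.apply_linearCombination] at hl
    have hl' := (Submodule.Quotient.mk_eq_zero _).mp hl
    rw [Submodule.submoduleOf, Submodule.mem_comap, Submodule.subtype_apply, hz, boundaries,
      hc2] at hl'
    obtain ⟨y, hy, hyd⟩ := hl'
    have hx : l.mapDomain Subtype.val ∈ F.piece i {(a : Fin n →₀ ℕ)} := by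
      clear hl hz hyd
      induction l using Finsupp.induction_linear with
      | zero => simp
      | add f g hf hg => rw [Finsupp.mapDomain_add]; exact add_mem hf hg
      | single b c =>
        rw [Finsupp.mapDomain_single, single_eq_smul_single_one]
        exact Submodule.smul_mem _ _ (hpiece b.1 b.2)
    have h0 := h.eq_zero_of_dBar_eq hmin hex hx hy (by rw [dBar_taylor]; exact hyd.symm)
    exact Finsupp.mapDomain_injective Subtype.val_injective (h0.trans Finsupp.mapDomain_zero.symm)
  have hspan : ⊤ ≤ Submodule.span k (Set.range (q ∘ z)) := by
    rintro w' -
    obtain ⟨⟨w, hwc, hwd⟩, rfl⟩ := Submodule.mkQ_surjective _ w'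
    rw [SetLike.mem_coe, hc1] at hwc
    obtain ⟨x, hx, y, hy, hxy⟩ := h.exists_of_cycle hex hwc (by rw [dBar_taylor]; exact hwd)
    -- Lifts the chain to a cycle whose class is in the span; it can be checked on the basis
    -- elements that make up `x`.
    have hW : (boundary k ∘ₗ φ) x ∈ ((Submodule.span k (Set.range (q ∘ z))).comap q).map
        (cycles k (Delta m a) ((i : ℤ) - 2)).subtype := by
      refine map_mem_of_single_mem (fun b hb hba => ?_) hx
      have hpb : p b := (hp b).2 ⟨by exact_mod_cast hb, hba⟩
      exact ⟨z ⟨b, hpb⟩, Submodule.subset_span ⟨⟨b, hpb⟩, rfl⟩, rfl⟩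
    obtain ⟨z', hz', hz'x⟩ := hW
    have : q ⟨w, by rw [hc1]; exact hwc, hwd⟩ = q z' := by
      refine (Submodule.Quotient.eq _).mpr ?_
      rw [Submodule.submoduleOf, Submodule.mem_comap, boundaries, hc2]
      refine ⟨y, hy, ?_⟩
      simp only [Submodule.subtype_apply, LinearMap.comp_apply] at hz'x
      rw [dBar_taylor] at hxy
      change boundary k y = w - z'.1
      rw [hz'x, ← hxy, add_sub_cancel_left]
    change q _ ∈ _
    rw [this]
    exact hz'
  refine ⟨Module.Basis.mk hli hspan, fun b => ⟨hcyc b.1 b.2, ?_⟩⟩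
  rw [Module.Basis.mk_apply]
  rfl

end MonomialResolution

/-! ### Taylor bases give homotopy equivalences -/

namespace MonomialResolution
open MultigradedComplex

theorem specializeMap_add {σ k B B' : Type*} [Field k]
    (D D' : (B →₀ MvPolynomial σ k) →ₗ[MvPolynomial σ k] (B' →₀ MvPolynomial σ k)) :
    specializeMap (D + D') = specializeMap D + specializeMap D' := by
  ext1 b; ext1
  simp [specializeMap_single]

variable {n r : ℕ} {k : Type*} [Field k] {m : Fin r → (Fin n →₀ ℕ)}

namespace MultigradedComplex

variable {F E T : MultigradedComplex n k}

/-- On `F ⊕ E` the defect `φ ψ - 1` is `-ι π`, and the contraction `h` of `E` makes it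
null-homotopic through `-ι h π`. On `F` no homotopy is needed. -/
theorem isHomotopyInverse_of_split {φ : (F.B →₀ k) →ₗ[k] (T.B →₀ k)}
    {ψ : (T.B →₀ k) →ₗ[k] (F.B →₀ k)} {ι : (E.B →₀ k) →ₗ[k] (T.B →₀ k)}
    {π : (T.B →₀ k) →ₗ[k] (E.B →₀ k)} {h : (E.B →₀ k) →ₗ[k] (E.B →₀ k)}
    (hφ : IsFiltered F T 0 φ) (hψ : IsFiltered T F 0 ψ) (hι : IsFiltered E T 0 ι)
    (hπ : IsFiltered T E 0 π) (hh : IsFiltered E E 1 h)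
    (hφd : ∀ x, φ (F.dBar x) = T.dBar (φ x)) (hιd : ∀ x, ι (E.dBar x) = T.dBar (ι x))
    (hhd : ∀ x, E.dBar (h x) + h (E.dBar x) = x)
    (hψφ : ∀ x, ψ (φ x) = x) (hψι : ∀ x, ψ (ι x) = 0)
    (hπφ : ∀ x, π (φ x) = 0) (hπι : ∀ x, π (ι x) = x) (hsum : ∀ x, φ (ψ x) + ι (π x) = x) :
    IsHomotopyInverse F T φ ψ 0 (-(ι ∘ₗ h ∘ₗ π)) where
  filtered_φ := hφ
  filtered_ψ := hψ
  filtered_hF := fun b => zero_mem _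
  filtered_hG := (hι.comp (hh.comp hπ (zero_add 1)) (add_zero 1)).neg
  φ_comm := hφd
  ψ_comm := fun x => by
    conv_lhs => rw [← hsum x, map_add, ← hφd, ← hιd, map_add, hψφ, hψι, add_zero]
  homotopy_F := fun x => by simp [hψφ]
  homotopy_G := fun x => by
    have h1 : π (T.dBar x) = E.dBar (π x) := by
      conv_lhs => rw [← hsum x, map_add, ← hφd, ← hιd, map_add, hπφ, hπι, zero_add]
    simp only [LinearMap.neg_apply, LinearMap.comp_apply, map_neg]
    rw [h1, ← hιd, add_assoc, ← neg_add, ← map_add, hhd, ← sub_eq_add_neg, eq_sub_iff_add_eq, hsum]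

theorem IsTrivial.exists_contraction (hE : E.IsTrivial) :
    ∃ h : (E.B →₀ k) →ₗ[k] (E.B →₀ k), IsFiltered E E 1 h ∧
      ∀ x, E.dBar (h x) + h (E.dBar x) = x := by
  obtain ⟨J, e, h1, h2⟩ := hE
  have d1 : ∀ j, E.dBar (Finsupp.single (e (Sum.inl j)) 1) =
      Finsupp.single (e (Sum.inr j)) 1 := fun j => by
    rw [dBar, specializeMap_single, h1, specialize_single, map_one]
  have d2 : ∀ j, E.dBar (Finsupp.single (e (Sum.inr j)) 1) = 0 := fun j => by
    rw [dBar, specializeMap_single, h2, map_zero]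
  let h : (E.B →₀ k) →ₗ[k] (E.B →₀ k) := Finsupp.linearCombination k fun b =>
    Sum.elim (fun _ => 0) (fun j => Finsupp.single (e (Sum.inl j)) 1) (e.symm b)
  have h1' : ∀ j, h (Finsupp.single (e (Sum.inl j)) 1) = 0 := fun j => by simp [h]
  have h2' : ∀ j, h (Finsupp.single (e (Sum.inr j)) 1) = Finsupp.single (e (Sum.inl j)) 1 :=
    fun j => by simp [h]
  refine ⟨h, fun b => ?_, fun x => ?_⟩
  · obtain ⟨j | j, rfl⟩ := e.surjective b
    · rw [h1']; exact zero_mem _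
    · rw [h2']
      -- The entry 1 has exponent 0 in its support, so both generators share a multidegree and lie
      -- in adjacent homological degrees.
      obtain ⟨h3, h4⟩ := E.d_homogeneous (e (Sum.inl j)) (e (Sum.inr j)) 0 (by simp [h1])
      rw [zero_add] at h4
      exact single_mem_piece (by omega) h4.ge _
  · suffices hs : E.dBar ∘ₗ h + h ∘ₗ E.dBar = LinearMap.id from LinearMap.congr_fun hs x
    ext1 b; ext1
    obtain ⟨j | j, rfl⟩ := e.surjective b
    · simp [h1', h2', d1]
    · simp [d1, h2', d2]

/-- The projection to the coordinates of homological degree `j`. -/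
noncomputable def hdegProj (F : MultigradedComplex n k) (j : ℕ) : (F.B →₀ k) →ₗ[k] (F.B →₀ k) :=
  Finsupp.linearCombination k fun b => if F.hdeg b = j then Finsupp.single b 1 else 0

theorem hdegProj_apply (j : ℕ) (x : F.B →₀ k) (b : F.B) :
    F.hdegProj j x b = if F.hdeg b = j then x b else 0 := by
  classical
  induction x using Finsupp.induction_linear with
  | zero => simp
  | add f g hf hg => simp only [map_add, Finsupp.add_apply, hf, hg]; split_ifs <;> simp
  | single c y =>
    by_cases h : c = b
    · subst h; simp [hdegProj]; split_ifs <;> simp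
    · simp [hdegProj, h]; split_ifs <;> simp [h]

theorem IsFiltered.hdegProj_map {φ : (F.B →₀ k) →ₗ[k] (T.B →₀ k)} (hφ : IsFiltered F T 0 φ)
    (j : ℕ) (x : F.B →₀ k) : T.hdegProj j (φ x) = φ (F.hdegProj j x) := by
  suffices hs : T.hdegProj j ∘ₗ φ = φ ∘ₗ F.hdegProj j from LinearMap.congr_fun hs x
  ext b c
  simp only [LinearMap.comp_apply, Finsupp.lsingle_apply, hdegProj_apply]
  by_cases h0 : φ (Finsupp.single b 1) c = 0
  · simp only [h0, ite_self]
    simp only [hdegProj, Finsupp.linearCombination_single, one_smul]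
    split_ifs <;> simp [h0]
  · have h1 := (mem_piece.mp (hφ b) c h0).1
    have h2 : T.hdeg c = j ↔ F.hdeg b = j := by omega
    simp only [hdegProj, Finsupp.linearCombination_single, one_smul, h2]
    split_ifs <;> simp

/-- The inverse of a multigraded base change is multigraded. -/
theorem isFiltered_of_split
    {Φ : (F.B →₀ MvPolynomial (Fin n) k) →ₗ[MvPolynomial (Fin n) k]
      (T.B →₀ MvPolynomial (Fin n) k)}
    {Ψ : (T.B →₀ MvPolynomial (Fin n) k) →ₗ[MvPolynomial (Fin n) k]
      (F.B →₀ MvPolynomial (Fin n) k)}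
    {I : (E.B →₀ MvPolynomial (Fin n) k) →ₗ[MvPolynomial (Fin n) k]
      (T.B →₀ MvPolynomial (Fin n) k)}
    {P : (T.B →₀ MvPolynomial (Fin n) k) →ₗ[MvPolynomial (Fin n) k]
      (E.B →₀ MvPolynomial (Fin n) k)}
    (hΦ : IsMultigraded F.mdeg T.mdeg Φ) (hI : IsMultigraded E.mdeg T.mdeg I)
    (hφ : IsFiltered F T 0 (specializeMap Φ)) (hι : IsFiltered E T 0 (specializeMap I))
    (hΨΦ : ∀ x, specializeMap Ψ (specializeMap Φ x) = x)
    (hΨI : ∀ x, specializeMap Ψ (specializeMap I x) = 0) (hsum : ∀ x, Φ (Ψ x) + I (P x) = x) :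
    IsFiltered T F 0 (specializeMap Ψ) := by
  intro A
  -- Since `Φ` and `I` respect degrees, the coordinates of the homogeneous element `A` may be
  -- truncated to the bidegree of `A`. Applying the specialized `Ψ` then shows that it returns only
  -- such coordinates.
  have h1 : Finsupp.single A 1 = specializeMap Φ (F.hdegProj (T.hdeg A)
      (strandProj F.mdeg (T.mdeg A) (Ψ (Finsupp.single A 1)))) +
      specializeMap I (E.hdegProj (T.hdeg A)
      (strandProj E.mdeg (T.mdeg A) (P (Finsupp.single A 1)))) := by
    rw [← hφ.hdegProj_map, ← hι.hdegProj_map, ← hΦ.strandProj_map, ← hI.strandProj_map, ← map_add,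
      ← map_add, hsum]
    classical
    ext C
    rw [hdegProj_apply, strandProj_apply, Finsupp.single_apply, Finsupp.single_apply]
    split_ifs with h <;> simp_all
  rw [h1, map_add, hΨΦ, hΨI, add_zero, add_zero, mem_piece]
  intro b hb
  rw [hdegProj_apply, strandProj_apply] at hb
  split_ifs at hb with h2 h3
  · exact ⟨by simp [h2], h3⟩
  · exact (hb rfl).elim
  · exact (hb rfl).elim

end MultigradedComplex

/-- The two halves of the new basis give the inclusions and its coordinate functionals the
projections. The splitting identities are checked over the polynomial ring and survive
specialization. -/
theorem IsTaylorBasis.exists_isHomotopyInverse {F : MultigradedComplex n k}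
    {g : F.B → (Finset (Fin r) →₀ k)} (hg : IsTaylorBasis m F g) :
    ∃ φ ψ hF hT, IsHomotopyInverse F (taylor k m) φ ψ hF hT ∧ (∀ x, ψ (φ x) = x) ∧
      ∀ b, φ (Finsupp.single b 1) = g b := by
  obtain ⟨E, f, hE, hfF, hfE, hdF, hdE, hgf⟩ := hg
  obtain ⟨h, hh, hhd⟩ := hE.exists_contraction
  let Φ : (F.B →₀ MvPolynomial (Fin n) k) →ₗ[MvPolynomial (Fin n) k] _ :=
    Finsupp.linearCombination (MvPolynomial (Fin n) k) fun c => f (Sum.inl c)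
  let I : (E.B →₀ MvPolynomial (Fin n) k) →ₗ[MvPolynomial (Fin n) k] _ :=
    Finsupp.linearCombination (MvPolynomial (Fin n) k) fun c => f (Sum.inr c)
  let Ψ := Finsupp.lcomapDomain (R := MvPolynomial (Fin n) k) (M := MvPolynomial (Fin n) k)
    (Sum.inl : F.B → F.B ⊕ E.B) Sum.inl_injective ∘ₗ f.repr.toLinearMap
  let P := Finsupp.lcomapDomain (R := MvPolynomial (Fin n) k) (M := MvPolynomial (Fin n) k)
    (Sum.inr : E.B → F.B ⊕ E.B) Sum.inr_injective ∘ₗ f.repr.toLinearMap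
  have hΦ1 : ∀ b, Φ (Finsupp.single b 1) = f (Sum.inl b) := fun b => by simp [Φ]
  have hI1 : ∀ b, I (Finsupp.single b 1) = f (Sum.inr b) := fun b => by simp [I]
  have hΦ : IsMultigraded F.mdeg (taylor k m).mdeg Φ := fun b c e he => by
    rw [hΦ1] at he; exact (hfF b c e he).2
  have hI : IsMultigraded E.mdeg (taylor k m).mdeg I := fun b c e he => by
    rw [hI1] at he; exact (hfE b c e he).2
  have hφ : IsFiltered F (taylor k m) 0 (specializeMap Φ) := fun b => by
    rw [mem_piece]
    refine fun c hc => ⟨?_, hΦ.le hc⟩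
    rw [specializeMap_single, hΦ1] at hc
    obtain ⟨e, he⟩ := support_of_specialize_ne_zero hc
    rw [(hfF b c e he).1, add_zero]
  have hι : IsFiltered E (taylor k m) 0 (specializeMap I) := fun b => by
    rw [mem_piece]
    refine fun c hc => ⟨?_, hI.le hc⟩
    rw [specializeMap_single, hI1] at hc
    obtain ⟨e, he⟩ := support_of_specialize_ne_zero hc
    rw [(hfE b c e he).1, add_zero]
  have e1 : Ψ ∘ₗ Φ = LinearMap.id := by
    ext1 b; ext1
    simp [Ψ, hΦ1]
  have e2 : Ψ ∘ₗ I = 0 := by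
    ext1 b; ext1
    simp [Ψ, hI1]
  have e3 : P ∘ₗ Φ = 0 := by
    ext1 b; ext1
    simp [P, hΦ1]
  have e4 : P ∘ₗ I = LinearMap.id := by
    ext1 b; ext1
    simp [P, hI1]
  have e5 : Φ ∘ₗ Ψ + I ∘ₗ P = LinearMap.id := by
    refine f.ext fun b => ?_
    rcases b with b | b
    · rw [← hΦ1]
      have h1 := LinearMap.congr_fun e1 (Finsupp.single b 1)
      have h2 := LinearMap.congr_fun e3 (Finsupp.single b 1)
      simp only [LinearMap.comp_apply] at h1 h2
      simp [h1, h2]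
    · rw [← hI1]
      have h1 := LinearMap.congr_fun e4 (Finsupp.single b 1)
      have h2 := LinearMap.congr_fun e2 (Finsupp.single b 1)
      simp only [LinearMap.comp_apply] at h1 h2
      simp [h1, h2]
  have e6 : Φ ∘ₗ F.d = (taylor k m).d ∘ₗ Φ := by
    ext1 b; ext1
    simp only [LinearMap.comp_apply, Finsupp.lsingle_apply, hΦ1]
    exact (hdF b).symm
  have e7 : I ∘ₗ E.d = (taylor k m).d ∘ₗ I := by
    ext1 b; ext1
    simp only [LinearMap.comp_apply, Finsupp.lsingle_apply, hI1]
    exact (hdE b).symm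
  have s1 : ∀ x, specializeMap Ψ (specializeMap Φ x) = x := fun x => by
    rw [← LinearMap.comp_apply, ← specializeMap_comp, e1, specializeMap_id, LinearMap.id_apply]
  have s4 : ∀ x, specializeMap P (specializeMap I x) = x := fun x => by
    rw [← LinearMap.comp_apply, ← specializeMap_comp, e4, specializeMap_id, LinearMap.id_apply]
  have hzero : ∀ {B B' : Type} (x : B →₀ k), specializeMap (0 : (B →₀ MvPolynomial (Fin n) k)
      →ₗ[MvPolynomial (Fin n) k] (B' →₀ MvPolynomial (Fin n) k)) x = 0 := fun x => by
    simp [specializeMap, Finsupp.linearCombination_apply]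
  have s2 : ∀ x, specializeMap Ψ (specializeMap I x) = 0 := fun x => by
    rw [← LinearMap.comp_apply, ← specializeMap_comp, e2, hzero]
  have s3 : ∀ x, specializeMap P (specializeMap Φ x) = 0 := fun x => by
    rw [← LinearMap.comp_apply, ← specializeMap_comp, e3, hzero]
  have s5 : ∀ x, specializeMap Φ (specializeMap Ψ x) + specializeMap I (specializeMap P x) = x :=
    fun x => by
      rw [← LinearMap.comp_apply, ← LinearMap.comp_apply, ← specializeMap_comp,
        ← specializeMap_comp, ← LinearMap.add_apply, ← specializeMap_add, e5, specializeMap_id,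
        LinearMap.id_apply]
  have s6 : ∀ x, specializeMap Φ (F.dBar x) = (taylor k m).dBar (specializeMap Φ x) := fun x => by
    rw [dBar, dBar, ← LinearMap.comp_apply, ← LinearMap.comp_apply, ← specializeMap_comp,
      ← specializeMap_comp, e6]
  have s7 : ∀ x, specializeMap I (E.dBar x) = (taylor k m).dBar (specializeMap I x) := fun x => by
    rw [dBar, dBar, ← LinearMap.comp_apply, ← LinearMap.comp_apply, ← specializeMap_comp,
      ← specializeMap_comp, e7]
  refine ⟨_, _, _, _, isHomotopyInverse_of_split hφ
    (isFiltered_of_split hΦ hI hφ hι s1 s2 (LinearMap.congr_fun e5)) hι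
    (isFiltered_of_split hI hΦ hι hφ s4 s3 (LinearMap.congr_fun ((add_comm _ _).trans e5)))
    hh s6 s7 hhd s1 s2 s3 s4 s5, s1, fun b => ?_⟩
  rw [specializeMap_single, hΦ1, hgf]
  ext A
  rw [specialize_apply]
  rfl

theorem chainMdeg_le_iff {c : Finset (Fin r) →₀ k} {u : Fin n →₀ ℕ} :
    chainMdeg m c ≤ u ↔ ∀ A, c A ≠ 0 → faceMdeg m A ≤ u := by
  simp [chainMdeg]

/-- If the chain had smaller multidegree, so would its image under `ψ`, which is `b` itself. -/
theorem MultigradedComplex.IsHomotopyInverse.chainMdeg_eq {F : MultigradedComplex n k}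
    {φ : (F.B →₀ k) →ₗ[k] (Finset (Fin r) →₀ k)} {ψ : (Finset (Fin r) →₀ k) →ₗ[k] (F.B →₀ k)}
    {hF : (F.B →₀ k) →ₗ[k] (F.B →₀ k)}
    {hT : (Finset (Fin r) →₀ k) →ₗ[k] (Finset (Fin r) →₀ k)}
    (h : IsHomotopyInverse F (taylor k m) φ ψ hF hT) (hψφ : ∀ x, ψ (φ x) = x) (b : F.B) :
    chainMdeg m (φ (Finsupp.single b 1)) = F.mdeg b := by
  refine le_antisymm ?_ ?_
  · rw [chainMdeg_le_iff]
    exact fun A hA => (mem_piece.mp (h.filtered_φ b) A hA).2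
  · have h1 : φ (Finsupp.single b 1) ∈ (taylor k m).piece (F.hdeg b)
        (Set.Iic (chainMdeg m (φ (Finsupp.single b 1)))) := by
      rw [mem_piece]
      intro A hA
      exact ⟨by simpa using (mem_piece.mp (h.filtered_φ b) A hA).1,
        chainMdeg_le_iff.mp le_rfl A hA⟩
    have h2 := h.filtered_ψ.map_mem rfl (isLowerSet_Iic _) h1
    rw [hψφ] at h2
    exact (mem_piece.mp h2 b (by simp)).2

end MonomialResolution

/-! ### The comparison theorem for strands -/

namespace MonomialResolution
namespace MultigradedComplex

variable {n : ℕ} {k : Type*} [Field k] {F G : MultigradedComplex n k}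

theorem eq_zero_of_mem_piece_neg {i : ℤ} (hi : i < 0) {U : Set (Fin n →₀ ℕ)} {x : F.B →₀ k}
    (hx : x ∈ F.piece i U) : x = 0 := by
  ext b
  by_contra hb
  have := (mem_piece.mp hx b hb).1
  omega

theorem exists_hdeg_lt (F : MultigradedComplex n k) : ∃ N, ∀ b, F.hdeg b < N := by
  have := F.finite_B
  obtain ⟨N, hN⟩ := (Set.finite_range F.hdeg).bddAbove
  exact ⟨N + 1, fun b => Nat.lt_succ_of_le (hN ⟨b, rfl⟩)⟩

/-- Construction of a multigraded map by recursion on the homological degree. -/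
theorem exists_isFiltered_of_step (s : ℤ) (Q : F.B → (G.B →₀ k) → (G.B →₀ k) → Prop)
    (step : ∀ φ, IsFiltered F G s φ → ∀ b,
      (∀ c, F.hdeg c < F.hdeg b →
        Q c (φ (F.dBar (Finsupp.single c 1))) (φ (Finsupp.single c 1))) →
      ∃ y ∈ G.piece (F.hdeg b + s) (Set.Iic (F.mdeg b)),
        Q b (φ (F.dBar (Finsupp.single b 1))) y) :
    ∃ φ, IsFiltered F G s φ ∧
      ∀ b, Q b (φ (F.dBar (Finsupp.single b 1))) (φ (Finsupp.single b 1)) := by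
  suffices h : ∀ N, ∃ φ, IsFiltered F G s φ ∧ ∀ b, F.hdeg b < N →
      Q b (φ (F.dBar (Finsupp.single b 1))) (φ (Finsupp.single b 1)) by
    obtain ⟨N, hN⟩ := F.exists_hdeg_lt
    obtain ⟨φ, h1, h2⟩ := h N
    exact ⟨φ, h1, fun b => h2 b (hN b)⟩
  intro N
  induction N with
  | zero => exact ⟨0, fun b => zero_mem _, fun b hb => by omega⟩
  | succ N ih =>
    obtain ⟨φ, hφ, hQ⟩ := ih
    -- Only values in homological degree `N` change. Boundaries of elements of degree at most `N`
    -- live in lower degrees, so the conditions already achieved persist.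
    have hy : ∀ b, ∃ y ∈ G.piece (F.hdeg b + s) (Set.Iic (F.mdeg b)),
        (F.hdeg b = N → Q b (φ (F.dBar (Finsupp.single b 1))) y) ∧
        (F.hdeg b ≠ N → y = φ (Finsupp.single b 1)) := by
      intro b
      by_cases hb : F.hdeg b = N
      · obtain ⟨y, hy, hyQ⟩ := step φ hφ b fun c hc => hQ c (hb ▸ hc)
        exact ⟨y, hy, fun _ => hyQ, fun h => (h hb).elim⟩
      · exact ⟨_, hφ b, fun h => (hb h).elim, fun _ => rfl⟩
    choose y hy1 hy2 hy3 using hy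
    have h1 : ∀ b, Finsupp.linearCombination k y (Finsupp.single b 1) = y b := fun b => by simp
    have h2 : ∀ i : ℤ, i ≠ N → ∀ x ∈ F.piece i Set.univ,
        Finsupp.linearCombination k y x = φ x := by
      intro i hi x hx
      have : (Finsupp.linearCombination k y - φ) x ∈ (⊥ : Submodule k (G.B →₀ k)) := by
        refine map_mem_of_single_mem (fun b hb _ => ?_) hx
        rw [Submodule.mem_bot, LinearMap.sub_apply, h1, hy3 b (by omega), sub_self]
      rwa [Submodule.mem_bot, LinearMap.sub_apply, sub_eq_zero] at this
    have h3 : ∀ b, F.hdeg b < N + 1 →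
        Finsupp.linearCombination k y (F.dBar (Finsupp.single b 1)) =
          φ (F.dBar (Finsupp.single b 1)) := fun b hb =>
      h2 (F.hdeg b + -1) (by omega) _ (piece_mono (Set.subset_univ _) (F.isFiltered_dBar b))
    refine ⟨Finsupp.linearCombination k y, fun b => by rw [h1]; exact hy1 b, fun b hb => ?_⟩
    rw [h3 b hb, h1]
    by_cases hbN : F.hdeg b = N
    · exact hy2 b hbN
    · rw [hy3 b hbN]
      exact hQ b (by omega)

/-- The strands of `F` resolve the monomial quotient ring with nonzero multidegrees outside `P`. -/
structure IsStrandResolution (F : MultigradedComplex n k) (P : Set (Fin n →₀ ℕ))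
    (ε : (F.B →₀ k) →ₗ[k] k) : Prop where
  aug_pos : ∀ b, F.hdeg b ≠ 0 → ε (Finsupp.single b 1) = 0
  aug_dBar : ∀ u ∉ P, ∀ i, ∀ x ∈ F.piece i (Set.Iic u), ε (F.dBar x) = 0
  aug_surj : ∀ u ∉ P, ∃ x ∈ F.piece 0 (Set.Iic u), ε x = 1
  exact_at : ∀ u, ∀ i : ℕ, ∀ x ∈ F.piece i (Set.Iic u), F.dBar x = 0 → (u ∈ P ∨ ε x = 0) →
    ∃ y ∈ F.piece (i + 1) (Set.Iic u), F.dBar y = x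

variable {P : Set (Fin n →₀ ℕ)} {εF : (F.B →₀ k) →ₗ[k] k} {εG : (G.B →₀ k) →ₗ[k] k}

theorem IsStrandResolution.aug_eq_zero (hF : F.IsStrandResolution P εF) {i : ℤ} (hi : i ≠ 0)
    {U : Set (Fin n →₀ ℕ)} {x : F.B →₀ k} (hx : x ∈ F.piece i U) : εF x = 0 := by
  have : εF x ∈ (⊥ : Submodule k k) :=
    map_mem_of_single_mem (fun b hb _ => hF.aug_pos b (by omega)) hx
  exact this

/-- The usual lifting along an exact complex, with each image chosen inside the strand of its basis
element so that the map is filtered. In multidegrees in `P` the quotient ring vanishes and no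
compatibility with the augmentations is required. -/
theorem IsStrandResolution.exists_lift (hP : IsUpperSet P) (hF : F.IsStrandResolution P εF)
    (hG : G.IsStrandResolution P εG) : ∃ φ, IsFiltered F G 0 φ ∧
      (∀ x, φ (F.dBar x) = G.dBar (φ x)) ∧
      ∀ b, F.mdeg b ∉ P → εG (φ (Finsupp.single b 1)) = εF (Finsupp.single b 1) := by
  obtain ⟨φ, hφ, hQ⟩ := exists_isFiltered_of_step (F := F) (G := G) 0
    (fun b v w => G.dBar w = v ∧ (F.mdeg b ∉ P → εG w = εF (Finsupp.single b 1))) (by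
      intro φ hφ b ih
      have hdb := F.isFiltered_dBar b
      have hv := hφ.map_mem rfl (isLowerSet_Iic _) hdb
      rcases Nat.eq_zero_or_eq_succ_pred (F.hdeg b) with h0 | h0
      · have hdb0 : F.dBar (Finsupp.single b 1) = 0 :=
          eq_zero_of_mem_piece_neg (by omega) hdb
        rw [hdb0, map_zero]
        by_cases hbP : F.mdeg b ∈ P
        · exact ⟨0, zero_mem _, map_zero _, fun h => (h hbP).elim⟩
        · obtain ⟨x, hx, hx1⟩ := hG.aug_surj _ hbP
          refine ⟨εF (Finsupp.single b 1) • x, ?_, ?_, fun _ => by simp [hx1]⟩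
          · rw [h0]; exact Submodule.smul_mem _ _ hx
          · exact eq_zero_of_mem_piece_neg (by norm_num : (0 + -1 : ℤ) < 0)
              (G.isFiltered_dBar.map_mem rfl (isLowerSet_Iic _) (Submodule.smul_mem _ _ hx))
      · set j := (F.hdeg b).pred
        have hdj : F.dBar (Finsupp.single b 1) ∈ F.piece j (Set.Iic (F.mdeg b)) := by
          have : (F.hdeg b : ℤ) + -1 = j := by omega
          rwa [this] at hdb
        have hvj := hφ.map_mem (add_zero _) (isLowerSet_Iic _) hdj
        have hcyc : G.dBar (φ (F.dBar (Finsupp.single b 1))) = 0 := by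
          have : (G.dBar ∘ₗ φ - φ ∘ₗ F.dBar) (F.dBar (Finsupp.single b 1)) ∈
              (⊥ : Submodule k (G.B →₀ k)) := by
            refine map_mem_of_single_mem (fun c hc _ => ?_) hdj
            rw [Submodule.mem_bot, LinearMap.sub_apply, LinearMap.comp_apply,
              LinearMap.comp_apply, (ih c (by omega)).1, sub_self]
          rwa [Submodule.mem_bot, LinearMap.sub_apply, LinearMap.comp_apply,
            LinearMap.comp_apply, F.dBar_dBar, map_zero, sub_zero] at this
        have haug : F.mdeg b ∈ P ∨ εG (φ (F.dBar (Finsupp.single b 1))) = 0 := by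
          by_cases hbP : F.mdeg b ∈ P
          · exact Or.inl hbP
          · right
            -- Basis elements occurring in the boundary divide a multidegree outside the upper set
            -- `P`, so they are outside `P` as well.
            have : (εG ∘ₗ φ - εF) (F.dBar (Finsupp.single b 1)) ∈ (⊥ : Submodule k k) := by
              refine map_mem_of_single_mem (fun c hc hcb => ?_) hdj
              rw [Submodule.mem_bot, LinearMap.sub_apply, LinearMap.comp_apply,
                (ih c (by omega)).2 fun h => hbP (hP hcb h), sub_self]
            rwa [Submodule.mem_bot, LinearMap.sub_apply, LinearMap.comp_apply,
              hF.aug_dBar _ hbP (F.hdeg b) _ (single_mem_piece rfl (by simp) _), sub_zero] at this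
        obtain ⟨y, hy, hdy⟩ := hG.exact_at _ j _ hvj hcyc haug
        have hy' : y ∈ G.piece (F.hdeg b + 0) (Set.Iic (F.mdeg b)) := by
          have : (F.hdeg b : ℤ) + 0 = j + 1 := by omega
          rwa [this]
        refine ⟨y, hy', hdy, fun _ => ?_⟩
        rw [hG.aug_eq_zero (by omega) hy, hF.aug_pos b (by omega)])
  refine ⟨φ, hφ, fun x => ?_, fun b => (hQ b).2⟩
  suffices h : φ ∘ₗ F.dBar = G.dBar ∘ₗ φ from LinearMap.congr_fun h x
  ext1 b; ext1
  exact (hQ b).1.symm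

/-- Inductively `ρ b - h (d b)` is a cycle, killed by the augmentation where that matters, hence a
boundary in the strand of `b`. -/
theorem IsStrandResolution.exists_homotopy (hG : G.IsStrandResolution P εG)
    {ρ : (F.B →₀ k) →ₗ[k] (G.B →₀ k)} (hρ : IsFiltered F G 0 ρ)
    (hρd : ∀ x, ρ (F.dBar x) = G.dBar (ρ x))
    (hε : ∀ b, F.mdeg b ∉ P → εG (ρ (Finsupp.single b 1)) = 0) :
    ∃ h, IsFiltered F G 1 h ∧ ∀ x, ρ x = G.dBar (h x) + h (F.dBar x) := by
  obtain ⟨h, hh, hQ⟩ := exists_isFiltered_of_step (F := F) (G := G) 1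
    (fun b v w => G.dBar w = ρ (Finsupp.single b 1) - v) (by
      intro h hh b ih
      have hdb := F.isFiltered_dBar b
      have hv := hh.map_mem (neg_add_cancel_right _ _) (isLowerSet_Iic _) hdb
      have hρb := hρ b
      rw [add_zero] at hρb
      refine hG.exact_at _ _ _ (sub_mem hρb hv) ?_ ?_
      · have : (G.dBar ∘ₗ h + h ∘ₗ F.dBar - ρ) (F.dBar (Finsupp.single b 1)) ∈
            (⊥ : Submodule k (G.B →₀ k)) := by
          refine map_mem_of_single_mem (fun c hc _ => ?_) hdb
          rw [Submodule.mem_bot, LinearMap.sub_apply, LinearMap.add_apply, LinearMap.comp_apply,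
            LinearMap.comp_apply, ih c (by omega), sub_add_cancel, sub_self]
        rw [Submodule.mem_bot, LinearMap.sub_apply, LinearMap.add_apply, LinearMap.comp_apply,
          LinearMap.comp_apply, F.dBar_dBar, map_zero, add_zero, hρd, sub_eq_zero] at this
        rw [map_sub, this, sub_self]
      · by_cases hbP : F.mdeg b ∈ P
        · exact Or.inl hbP
        · right
          rw [map_sub, hε b hbP, zero_sub, neg_eq_zero]
          rcases Nat.eq_zero_or_pos (F.hdeg b) with h0 | h0
          · rw [eq_zero_of_mem_piece_neg (by omega) hdb, map_zero, map_zero]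
          · exact hG.aug_eq_zero (by omega) hv)
  refine ⟨h, hh, fun x => ?_⟩
  suffices hs : ρ = G.dBar ∘ₗ h + h ∘ₗ F.dBar from LinearMap.congr_fun hs x
  ext1 b; ext1
  simp [hQ b]

theorem IsStrandResolution.exists_isHomotopyInverse (hP : IsUpperSet P)
    (hF : F.IsStrandResolution P εF) (hG : G.IsStrandResolution P εG) :
    ∃ φ ψ hF hG, IsHomotopyInverse F G φ ψ hF hG := by
  obtain ⟨φ, hφ, hφd, hφε⟩ := hF.exists_lift hP hG
  obtain ⟨ψ, hψ, hψd, hψε⟩ := hG.exists_lift hP hF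
  -- Stated for an arbitrary pair so as to serve both compositions.
  have key : ∀ {F G : MultigradedComplex n k} {εF : (F.B →₀ k) →ₗ[k] k}
      {εG : (G.B →₀ k) →ₗ[k] k} (_ : F.IsStrandResolution P εF)
      {φ : (F.B →₀ k) →ₗ[k] (G.B →₀ k)} {ψ : (G.B →₀ k) →ₗ[k] (F.B →₀ k)}
      (_ : IsFiltered F G 0 φ) (_ : ∀ x, φ (F.dBar x) = G.dBar (φ x))
      (_ : ∀ b, F.mdeg b ∉ P → εG (φ (Finsupp.single b 1)) = εF (Finsupp.single b 1))
      (_ : IsFiltered G F 0 ψ) (_ : ∀ x, ψ (G.dBar x) = F.dBar (ψ x))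
      (_ : ∀ b, G.mdeg b ∉ P → εF (ψ (Finsupp.single b 1)) = εG (Finsupp.single b 1)),
      ∃ h, IsFiltered F F 1 h ∧ ∀ x, ψ (φ x) = x + F.dBar (h x) + h (F.dBar x) := by
    intro F G εF εG hF φ ψ hφ hφd hφε hψ hψd hψε
    obtain ⟨h, hh, hh'⟩ := hF.exists_homotopy (ρ := ψ ∘ₗ φ - LinearMap.id)
      ((hψ.comp hφ (add_zero 0)).sub isFiltered_id)
      (fun x => by simp [hφd, hψd]) (fun b hb => by
        have : (εF ∘ₗ ψ - εG) (φ (Finsupp.single b 1)) ∈ (⊥ : Submodule k k) := by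
          refine map_mem_of_single_mem (fun c _ hcb => ?_) (hφ b)
          rw [Submodule.mem_bot, LinearMap.sub_apply, LinearMap.comp_apply,
            hψε c (fun h => hb (hP hcb h)), sub_self]
        rw [Submodule.mem_bot, LinearMap.sub_apply, LinearMap.comp_apply, hφε b hb] at this
        simpa using this)
    refine ⟨h, hh, fun x => ?_⟩
    rw [add_assoc, ← hh']
    simp
  obtain ⟨h, hh, hh'⟩ := key hF hφ hφd hφε hψ hψd hψε
  obtain ⟨h', hh1, hh1'⟩ := key hG hψ hψd hψε hφ hφd hφε
  exact ⟨φ, ψ, h, h', ⟨hφ, hψ, hh, hh1, hφd, hψd, hh', hh1'⟩⟩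

end MultigradedComplex
end MonomialResolution

/-! ### Free resolutions versus exact strands -/

namespace MonomialResolution

variable {n : ℕ} {k : Type*} [Field k]

/-- The ideal `M` is determined by the monomials that it contains. -/
def IsMonomialIdeal (M : Ideal (MvPolynomial (Fin n) k)) : Prop :=
  ∀ f, f ∈ M ↔ ∀ e ∈ f.support, monomial e (1 : k) ∈ M

/-- The exponents of the monomials in `M`. -/
def exponents (M : Ideal (MvPolynomial (Fin n) k)) : Set (Fin n →₀ ℕ) :=
  {u | monomial u (1 : k) ∈ M}

theorem isUpperSet_exponents (M : Ideal (MvPolynomial (Fin n) k)) : IsUpperSet (exponents M) := by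
  intro u v huv hu
  have : monomial v (1 : k) = monomial (v - u) 1 * monomial u 1 := by
    rw [monomial_mul, tsub_add_cancel_of_le huv, one_mul]
  rw [exponents, Set.mem_ofPred_eq, this]
  exact M.mul_mem_left _ hu

theorem IsMonomialIdeal.coeff_eq_zero {M : Ideal (MvPolynomial (Fin n) k)}
    (hM : IsMonomialIdeal M) {f : MvPolynomial (Fin n) k} (hf : f ∈ M) {u : Fin n →₀ ℕ}
    (hu : u ∉ exponents M) : coeff u f = 0 := by
  by_contra h
  exact hu ((hM f).1 hf u (mem_support_iff.mpr h))

theorem monomial_mem_of_mem_exponents {M : Ideal (MvPolynomial (Fin n) k)} {u : Fin n →₀ ℕ}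
    (hu : u ∈ exponents M) (c : k) : monomial u c ∈ M := by
  rw [← mul_one c, ← C_mul_monomial]
  exact M.mul_mem_left _ hu

theorem isMonomialIdeal_span {r : ℕ} (m : Fin r → (Fin n →₀ ℕ)) :
    IsMonomialIdeal (Ideal.span (Set.range fun j => monomial (m j) (1 : k))) := by
  have h : (Set.range fun j => monomial (m j) (1 : k)) =
      (fun s => monomial s (1 : k)) '' Set.range m := by
    rw [← Set.range_comp]; rfl
  intro f
  rw [h, mem_ideal_span_monomial_image]
  refine forall₂_congr fun e _ => ?_
  rw [mem_ideal_span_monomial_image]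
  classical
  simp [support_monomial]

theorem mem_exponents_span {r : ℕ} (m : Fin r → (Fin n →₀ ℕ)) (u : Fin n →₀ ℕ) :
    u ∈ exponents (Ideal.span (Set.range fun j => monomial (m j) (1 : k))) ↔ ∃ j, m j ≤ u := by
  have h : (Set.range fun j => monomial (m j) (1 : k)) =
      (fun s => monomial s (1 : k)) '' Set.range m := by
    rw [← Set.range_comp]; rfl
  rw [exponents, Set.mem_ofPred_eq, h, mem_ideal_span_monomial_image]
  classical
  simp [support_monomial]

namespace MultigradedComplex

variable {F : MultigradedComplex n k}

/-- The multigraded map `F → S` that sends a basis element `b` to `c b • x ^ mdeg b`. -/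
noncomputable def augmentation (F : MultigradedComplex n k) (c : F.B → k) :
    (F.B →₀ MvPolynomial (Fin n) k) →ₗ[MvPolynomial (Fin n) k] MvPolynomial (Fin n) k :=
  Finsupp.linearCombination _ fun b => monomial (F.mdeg b) (c b)

theorem augmentation_single (c : F.B → k) (b : F.B) (p : MvPolynomial (Fin n) k) :
    F.augmentation c (Finsupp.single b p) = p * monomial (F.mdeg b) (c b) := by
  simp [augmentation]

theorem coeff_augmentation (c : F.B → k) (u : Fin n →₀ ℕ) (f : F.B →₀ MvPolynomial (Fin n) k) :
    coeff u (F.augmentation c f) = Finsupp.linearCombination k c (strandProj F.mdeg u f) := by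
  classical
  induction f using Finsupp.induction_linear with
  | zero => simp
  | add f g hf hg => simp [hf, hg]
  | single b p =>
    induction p using MvPolynomial.induction_on' with
    | add p q hp hq => simp only [Finsupp.single_add, map_add, coeff_add, hp, hq]
    | monomial e y =>
      rw [augmentation_single, strandProj_single_monomial, monomial_mul, coeff_monomial, map_smul,
        Finsupp.linearCombination_single, one_smul, smul_eq_mul, ite_mul, zero_mul]
      split_ifs <;> rfl

theorem augmentation_strandIncl (c : F.B → k) {u : Fin n →₀ ℕ} {i : ℤ} {x : F.B →₀ k}
    (hx : x ∈ F.piece i (Set.Iic u)) : F.augmentation c (strandIncl F.mdeg u x) =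
      monomial u (Finsupp.linearCombination k c x) := by
  have : ((F.augmentation c).restrictScalars k ∘ₗ strandIncl F.mdeg u -
      monomial u ∘ₗ Finsupp.linearCombination k c) x ∈
        (⊥ : Submodule k (MvPolynomial (Fin n) k)) := by
    refine map_mem_of_single_mem (fun b _ hb => ?_) hx
    simp only [Submodule.mem_bot, LinearMap.sub_apply, LinearMap.comp_apply, strandIncl_single,
      LinearMap.restrictScalars_apply, augmentation_single, monomial_mul,
      Finsupp.linearCombination_single, one_smul, one_mul]
    rw [tsub_add_cancel_of_le hb, sub_self]
  simpa [sub_eq_zero] using this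

theorem strandIncl_mem_part {i : ℕ} {U : Set (Fin n →₀ ℕ)} {x : F.B →₀ k} (hx : x ∈ F.piece i U)
    (u : Fin n →₀ ℕ) : strandIncl F.mdeg u x ∈ F.part i := by
  rw [part, Finsupp.mem_supported']
  intro b hb
  rw [strandIncl_apply]
  by_contra h
  have : x b ≠ 0 := fun h0 => h (by simp [h0])
  exact hb (by exact_mod_cast (mem_piece.mp hx b this).1)

theorem strandProj_mem_piece {i : ℕ} {f : F.B →₀ MvPolynomial (Fin n) k} (hf : f ∈ F.part i)
    (u : Fin n →₀ ℕ) : strandProj F.mdeg u f ∈ F.piece i (Set.Iic u) := by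
  rw [part, Finsupp.mem_supported'] at hf
  rw [mem_piece]
  intro b hb
  rw [strandProj_apply] at hb
  split_ifs at hb with h
  · refine ⟨?_, h⟩
    by_contra hi
    exact hb (by rw [hf b (by simpa using hi), coeff_zero])
  · exact (hb rfl).elim

theorem strandProj_strandIncl_of_mem {u : Fin n →₀ ℕ} {i : ℤ} {x : F.B →₀ k}
    (hx : x ∈ F.piece i (Set.Iic u)) : strandProj F.mdeg u (strandIncl F.mdeg u x) = x :=
  strandProj_strandIncl fun b hb => (mem_piece.mp hx b hb).2

theorem d_strandIncl {u : Fin n →₀ ℕ} {i : ℤ} {x : F.B →₀ k} (hx : x ∈ F.piece i (Set.Iic u)) :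
    F.d (strandIncl F.mdeg u x) = strandIncl F.mdeg u (F.dBar x) :=
  F.isMultigraded_d.map_strandIncl fun b hb => (mem_piece.mp hx b hb).2

theorem strandProj_d (u : Fin n →₀ ℕ) (f : F.B →₀ MvPolynomial (Fin n) k) :
    strandProj F.mdeg u (F.d f) = F.dBar (strandProj F.mdeg u f) :=
  F.isMultigraded_d.strandProj_map u f

variable {M : Ideal (MvPolynomial (Fin n) k)}

/-- Take components of multidegree `u`: there `S / M` is `k` or 0 according to whether `x ^ u` is
outside or inside `M`, and the augmentation, lifted to `S`, becomes a linear form on coefficients.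
-/
theorem IsFreeResolution.exists_isStrandResolution (hM : IsMonomialIdeal M)
    (h : F.IsFreeResolution M) : ∃ ε, F.IsStrandResolution (exponents M) ε := by
  obtain ⟨ε, hε0, hεpos, hsurj, hex0, hex⟩ := h
  have hc : ∀ b, ∃ y : k, ε (Finsupp.single b 1) = Ideal.Quotient.mk M (monomial (F.mdeg b) y) ∧
      (F.hdeg b ≠ 0 → y = 0) := by
    intro b
    by_cases hb : F.hdeg b = 0
    · obtain ⟨y, hy⟩ := hε0 b hb
      exact ⟨y, hy, fun h => (h hb).elim⟩
    · exact ⟨0, by rw [hεpos b hb]; simp, fun _ => rfl⟩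
  choose c hc1 hc2 using hc
  have hε : ∀ f, ε f = Ideal.Quotient.mk M (F.augmentation c f) := by
    intro f
    have : ε = (Submodule.mkQ M) ∘ₗ F.augmentation c := by
      ext1 b; ext1
      simp only [LinearMap.comp_apply, Finsupp.lsingle_apply, augmentation_single, one_mul]
      exact hc1 b
    rw [this]; rfl
  have hpos : ∀ b, F.hdeg b ≠ 0 → Finsupp.linearCombination k c (Finsupp.single b 1) = 0 :=
    fun b hb => by simp [hc2 b hb]
  refine ⟨Finsupp.linearCombination k c, hpos, ?_, ?_, ?_⟩
  · intro u hu i x hx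
    have hdx := F.isFiltered_dBar.map_mem rfl (isLowerSet_Iic u) hx
    by_cases hi : i = 1
    · subst hi
      have h1 : ε (F.d (strandIncl F.mdeg u x)) = 0 :=
        (hex0 _ (by rw [d_strandIncl hx]; exact strandIncl_mem_part (i := 0) hdx u)).2
          ⟨_, strandIncl_mem_part (i := 1) hx u, rfl⟩
      rw [d_strandIncl hx, hε, augmentation_strandIncl c hdx, Ideal.Quotient.eq_zero_iff_mem] at h1
      simpa using hM.coeff_eq_zero h1 hu
    · have : Finsupp.linearCombination k c (F.dBar x) ∈ (⊥ : Submodule k k) :=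
        map_mem_of_single_mem (fun b hb _ => hpos b (by omega)) hdx
      exact this
  · intro u hu
    obtain ⟨f, hf⟩ := hsurj (Ideal.Quotient.mk M (monomial u 1))
    rw [hε, Ideal.Quotient.eq] at hf
    have h1 := hM.coeff_eq_zero hf hu
    rw [coeff_sub, coeff_augmentation, coeff_monomial, if_pos rfl, sub_eq_zero] at h1
    -- The preimage may have coordinates in positive homological degree; the augmentation ignores
    -- them, so they are dropped.
    refine ⟨F.hdegProj 0 (strandProj F.mdeg u f), ?_, ?_⟩
    · rw [mem_piece]
      intro b hb
      rw [hdegProj_apply, strandProj_apply] at hb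
      split_ifs at hb with h2 h3
      · exact ⟨by simp [h2], h3⟩
      · exact (hb rfl).elim
      · exact (hb rfl).elim
    · rw [← h1]
      suffices hs : Finsupp.linearCombination k c ∘ₗ F.hdegProj 0 =
          Finsupp.linearCombination k c from LinearMap.congr_fun hs _
      ext b
      by_cases hb : F.hdeg b = 0
      · simp [hdegProj, hb]
      · simp [hdegProj, hb, hc2]
  · intro u i x hx hdx hux
    have key : ∃ g ∈ F.part (i + 1), F.d g = strandIncl F.mdeg u x := by
      rcases Nat.eq_zero_or_pos i with rfl | hi
      · refine (hex0 _ (strandIncl_mem_part hx u)).1 ?_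
        rw [hε, augmentation_strandIncl c hx, Ideal.Quotient.eq_zero_iff_mem]
        rcases hux with hu | h0
        · exact monomial_mem_of_mem_exponents hu _
        · rw [h0, map_zero]; exact zero_mem _
      · refine (hex i hi _ (strandIncl_mem_part hx u)).1 ?_
        rw [d_strandIncl hx, hdx, map_zero]
    obtain ⟨g, hg, hdg⟩ := key
    refine ⟨strandProj F.mdeg u g, by exact_mod_cast strandProj_mem_piece hg u, ?_⟩
    rw [← strandProj_d, hdg, strandProj_strandIncl_of_mem hx]

/-- Solutions in the finitely many multidegrees that occur in `f` add up to a solution for `f`. -/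
theorem exists_d_eq_of_strands {i : ℕ} {f : F.B →₀ MvPolynomial (Fin n) k}
    (h : ∀ u, ∃ y ∈ F.piece (i + 1) (Set.Iic u), F.dBar y = strandProj F.mdeg u f) :
    ∃ g ∈ F.part (i + 1), F.d g = f := by
  choose y hy hdy using h
  obtain ⟨U, hU⟩ := exists_eq_sum_strandIncl F.mdeg f
  refine ⟨∑ u ∈ U, strandIncl F.mdeg u (y u), sum_mem fun u _ =>
    strandIncl_mem_part (by exact_mod_cast hy u) u, ?_⟩
  rw [map_sum]
  conv_rhs => rw [hU]
  exact Finset.sum_congr rfl fun u _ => by rw [d_strandIncl (hy u), hdy]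

theorem IsStrandResolution.isFreeResolution (hM : IsMonomialIdeal M) {ε : (F.B →₀ k) →ₗ[k] k}
    (h : F.IsStrandResolution (exponents M) ε) : F.IsFreeResolution M := by
  set c : F.B → k := fun b => ε (Finsupp.single b 1) with hc
  have hε : Finsupp.linearCombination k c = ε := by
    ext1 b; ext1
    simp [hc]
  have hE : ∀ f, Submodule.mkQ M (F.augmentation c f) = 0 ↔
      ∀ u, u ∈ exponents M ∨ ε (strandProj F.mdeg u f) = 0 := by
    intro f
    rw [Submodule.mkQ_apply, Submodule.Quotient.mk_eq_zero, hM]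
    refine forall_congr' fun u => ?_
    rw [mem_support_iff, coeff_augmentation, hε, ne_eq, or_iff_not_imp_right]
    rfl
  refine ⟨Submodule.mkQ M ∘ₗ F.augmentation c, fun b _ => ⟨c b, ?_⟩, fun b hb => ?_, ?_, ?_, ?_⟩
  · rw [LinearMap.comp_apply, augmentation_single, one_mul]; rfl
  · rw [LinearMap.comp_apply, augmentation_single, hc]
    simp [h.aug_pos b hb]
  -- By linearity it suffices to hit the class of 1, which is 0 when `M` is the unit ideal.
  · have h1 : ∃ f, Submodule.mkQ M (F.augmentation c f) = Submodule.mkQ M 1 := by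
      by_cases h0 : 0 ∈ exponents M
      · refine ⟨0, ?_⟩
        have : (1 : MvPolynomial (Fin n) k) ∈ M := h0
        rw [map_zero, map_zero, Submodule.mkQ_apply, eq_comm, Submodule.Quotient.mk_eq_zero]
        exact this
      · obtain ⟨x, hx, hx1⟩ := h.aug_surj 0 h0
        refine ⟨strandIncl F.mdeg 0 x, ?_⟩
        rw [augmentation_strandIncl c hx, hε, hx1]; rfl
    obtain ⟨f, hf⟩ := h1
    intro q
    obtain ⟨p, rfl⟩ := Submodule.mkQ_surjective _ q
    refine ⟨p • f, ?_⟩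
    rw [map_smul, LinearMap.comp_apply, hf, ← map_smul, smul_eq_mul, mul_one]
  · intro f hf
    rw [LinearMap.comp_apply, hE]
    constructor
    · intro hu
      refine exists_d_eq_of_strands fun u => ?_
      have hp := strandProj_mem_piece hf u
      exact h.exact_at u 0 _ hp (eq_zero_of_mem_piece_neg (by norm_num)
        (F.isFiltered_dBar.map_mem rfl (isLowerSet_Iic u) hp)) (hu u)
    · rintro ⟨g, hg, rfl⟩ u
      by_cases hu : u ∈ exponents M
      · exact Or.inl hu
      · rw [strandProj_d]
        exact Or.inr (h.aug_dBar u hu _ _ (strandProj_mem_piece hg u))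
  · intro i hi f hf
    constructor
    · intro hdf
      refine exists_d_eq_of_strands fun u => ?_
      have hp := strandProj_mem_piece hf u
      exact h.exact_at u i _ hp (by rw [← strandProj_d, hdf, map_zero])
        (Or.inr (h.aug_eq_zero (by omega) hp))
    · rintro ⟨g, -, rfl⟩
      exact LinearMap.congr_fun F.d_comp_d g

end MultigradedComplex
end MonomialResolution

/-! ### The Taylor resolution and existence of minimal resolutions -/

namespace MonomialResolution
open MultigradedComplex

variable {n r : ℕ} {k : Type*} [Field k]

/-- For `u ∈ P` the strand is a cone; for `u ∉ P` the empty face is the only one in it. -/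
theorem isStrandResolution_taylor (m : Fin r → (Fin n →₀ ℕ)) {P : Set (Fin n →₀ ℕ)}
    (hP : ∀ u, u ∈ P ↔ ∃ j, m j ≤ u) : (taylor k m).IsStrandResolution P
      (Finsupp.linearCombination k fun A => if A = ∅ then 1 else 0) := by
  have hempty : ∀ u ∉ P, ∀ A, faceMdeg m A ≤ u → A = ∅ := by
    intro u hu A hA
    by_contra hne
    obtain ⟨j, hj⟩ := Finset.nonempty_iff_ne_empty.mpr hne
    exact hu ((hP u).2 ⟨j, (Finset.le_sup (f := m) hj).trans hA⟩)
  refine ⟨fun A hA => ?_, fun u hu i x hx => ?_, fun u _ => ?_, fun u i x hx hdx hux => ?_⟩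
  · have : A ≠ ∅ := fun h => hA (by simp [h])
    simp [this]
  · have : (Finsupp.linearCombination k (fun A : Finset (Fin r) => if A = ∅ then (1 : k) else 0) ∘ₗ
        (taylor k m).dBar) x ∈ (⊥ : Submodule k k) := by
      refine map_mem_of_single_mem (fun A _ hA => ?_) hx
      rw [hempty u hu A hA, LinearMap.comp_apply, dBar_taylor, boundary_single]
      simp
    exact this
  · exact ⟨Finsupp.single ∅ 1, single_mem_piece (by simp) (by simp [faceMdeg]) _, by simp⟩
  · by_cases hu : u ∈ P
    · obtain ⟨v, hv⟩ := (hP u).1 hu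
      exact isExactAt_taylor hv i x hx hdx
    · have h0 := hux.resolve_left hu
      have hx0 : x = Finsupp.single ∅ (x ∅) := by
        ext A
        by_cases hA : A = ∅
        · simp [hA]
        · rw [Finsupp.single_eq_of_ne hA]
          by_contra h
          exact hA (hempty u hu A (mem_piece.mp hx A h).2)
      rw [hx0] at h0
      simp only [Finsupp.linearCombination_single, if_pos, smul_eq_mul, mul_one] at h0
      rw [h0, Finsupp.single_zero] at hx0
      exact ⟨0, zero_mem _, by rw [hx0, map_zero]⟩

namespace MultigradedComplex

variable {F : MultigradedComplex n k} {M : Ideal (MvPolynomial (Fin n) k)}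

theorem map_mem_of_mem_part {V : Type*} [AddCommGroup V] [Module (MvPolynomial (Fin n) k) V]
    {i : ℕ} {φ : (F.B →₀ MvPolynomial (Fin n) k) →ₗ[MvPolynomial (Fin n) k] V}
    {W : Submodule (MvPolynomial (Fin n) k) V}
    (h : ∀ b, F.hdeg b = i → φ (Finsupp.single b 1) ∈ W) {f : F.B →₀ MvPolynomial (Fin n) k}
    (hf : f ∈ F.part i) : φ f ∈ W := by
  have : F.part i ≤ W.comap φ := by
    rw [part, Finsupp.supported_eq_span_single, Submodule.span_le]
    rintro _ ⟨b, hb, rfl⟩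
    exact h b hb
  exact this hf

theorem mem_part {i : ℕ} {f : F.B →₀ MvPolynomial (Fin n) k} :
    f ∈ F.part i ↔ ∀ b, f b ≠ 0 → F.hdeg b = i := by
  rw [part, Finsupp.mem_supported']
  exact forall_congr' fun b => not_imp_comm

theorem hdeg_of_d_ne_zero {b c : F.B} (h : F.d (Finsupp.single b 1) c ≠ 0) :
    F.hdeg c + 1 = F.hdeg b := by
  obtain ⟨e, he⟩ := support_nonempty.mpr h
  exact (F.d_homogeneous b c e he).1

theorem d_mem_part {i j : ℕ} (hij : j + 1 = i) {f : F.B →₀ MvPolynomial (Fin n) k}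
    (hf : f ∈ F.part i) : F.d f ∈ F.part j :=
  map_mem_of_mem_part (fun b hb => mem_part.mpr fun c hc => by
    have := hdeg_of_d_ne_zero hc; omega) hf

theorem d_d (F : MultigradedComplex n k) (f : F.B →₀ MvPolynomial (Fin n) k) :
    F.d (F.d f) = 0 := LinearMap.congr_fun F.d_comp_d f

/-- The quotient of `F` by the short trivial complex spanned by a basis element `b₀` and its
boundary, in whose expansion the basis element `c₀` has the invertible coefficient `l`. -/
theorem exists_cancel {b₀ c₀ : F.B} {l : k} (hl : l ≠ 0)
    (hbc : F.d (Finsupp.single b₀ 1) c₀ = C l) :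
    ∃ (F' : MultigradedComplex n k)
      (ι : (F'.B →₀ MvPolynomial (Fin n) k) →ₗ[MvPolynomial (Fin n) k]
        (F.B →₀ MvPolynomial (Fin n) k))
      (p : (F.B →₀ MvPolynomial (Fin n) k) →ₗ[MvPolynomial (Fin n) k]
        (F'.B →₀ MvPolynomial (Fin n) k)),
      Nat.card F'.B < Nat.card F.B ∧
      (∀ x, F'.d x = p (F.d (ι x))) ∧
      (∀ x, p (ι x) = x) ∧
      p (Finsupp.single b₀ 1) = 0 ∧
      p (F.d (Finsupp.single b₀ 1)) = 0 ∧
      (∀ x, ∃ α : MvPolynomial (Fin n) k, x = ι (p x) + α • Finsupp.single b₀ 1 +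
        (C l⁻¹ * x c₀) • F.d (Finsupp.single b₀ 1)) ∧
      (∀ i, ∀ x ∈ F'.part i, ι x ∈ F.part i) ∧
      (∀ i, ∀ x ∈ F.part i, p x ∈ F'.part i) ∧
      (∀ b, ∃ b', F'.hdeg b = F.hdeg b' ∧ F'.mdeg b = F.mdeg b' ∧
        ι (Finsupp.single b 1) = Finsupp.single b' 1) := by
  classical
  have hCl : C l⁻¹ * C l = (1 : MvPolynomial (Fin n) k) := by
    rw [← C_mul, inv_mul_cancel₀ hl, C_1]
  have hdeg0 : F.hdeg c₀ + 1 = F.hdeg b₀ := hdeg_of_d_ne_zero (by rw [hbc]; simpa using hl)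
  have hmdeg0 : F.mdeg c₀ = F.mdeg b₀ := by
    have := (F.d_homogeneous b₀ c₀ 0 (by rw [hbc]; simpa using hl)).2
    rwa [zero_add] at this
  have hne : b₀ ≠ c₀ := by rintro rfl; omega
  let B' := {b : F.B // b ≠ b₀ ∧ b ≠ c₀}
  let ι : (B' →₀ MvPolynomial (Fin n) k) →ₗ[MvPolynomial (Fin n) k]
      (F.B →₀ MvPolynomial (Fin n) k) := Finsupp.lmapDomain _ _ Subtype.val
  -- Clears the coordinate at `c₀` by subtracting a multiple of the boundary of `b₀`, then forgets
  -- `b₀` and `c₀`.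
  let p : (F.B →₀ MvPolynomial (Fin n) k) →ₗ[MvPolynomial (Fin n) k]
      (B' →₀ MvPolynomial (Fin n) k) :=
    Finsupp.lcomapDomain Subtype.val Subtype.val_injective ∘ₗ
      (LinearMap.id - (Finsupp.lapply c₀).smulRight
        ((C l⁻¹ : MvPolynomial (Fin n) k) • F.d (Finsupp.single b₀ 1)))
  have hp : ∀ x (c : B'), p x c = x c.1 - C l⁻¹ * x c₀ * F.d (Finsupp.single b₀ 1) c.1 := by
    intro x c
    simp [p, Finsupp.lcomapDomain]
    ring
  have hι1 : ∀ x (c : B'), ι x c.1 = x c := fun x c =>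
    Finsupp.mapDomain_apply Subtype.val_injective x c
  have hι0 : ∀ x b, (b = b₀ ∨ b = c₀) → ι x b = 0 := fun x b hb =>
    Finsupp.mapDomain_of_notMem_range x b (by rintro ⟨c, rfl⟩; have := c.2; tauto)
  have hιs : ∀ b : B', ι (Finsupp.single b 1) = Finsupp.single b.1 1 := fun b => by simp [ι]
  have hpι : ∀ x, p (ι x) = x := by
    intro x; ext1 c
    rw [hp, hι1, hι0 x c₀ (Or.inr rfl), mul_zero, zero_mul, sub_zero]
  have hpd : p (F.d (Finsupp.single b₀ 1)) = 0 := by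
    ext1 c
    rw [hp, hbc, hCl, one_mul, sub_self, Finsupp.zero_apply]
  have hpb : p (Finsupp.single b₀ 1) = 0 := by
    ext1 c
    rw [hp, Finsupp.single_eq_of_ne c.2.1, Finsupp.single_eq_of_ne hne.symm]
    simp
  have hdecomp : ∀ x, ∃ α : MvPolynomial (Fin n) k, x = ι (p x) + α • Finsupp.single b₀ 1 +
      (C l⁻¹ * x c₀) • F.d (Finsupp.single b₀ 1) := by
    intro x
    -- What remains at `b₀` after the coordinate at `c₀` has been cleared.
    refine ⟨x b₀ - C l⁻¹ * x c₀ * F.d (Finsupp.single b₀ 1) b₀, ?_⟩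
    ext1 b
    simp only [Finsupp.add_apply, Finsupp.smul_apply, smul_eq_mul]
    by_cases h1 : b = b₀
    · subst h1
      rw [hι0 _ _ (Or.inl rfl), Finsupp.single_eq_same]
      ring
    · rw [Finsupp.single_eq_of_ne h1]
      by_cases h2 : b = c₀
      · subst h2
        rw [hι0 _ _ (Or.inr rfl), hbc]
        linear_combination (- x b) * hCl
      · rw [hι1 _ ⟨b, h1, h2⟩, hp]
        ring
  have hd' : ∀ b c : B', ∀ e ∈ ((p ∘ₗ F.d ∘ₗ ι) (Finsupp.single b 1) c).support,
      F.hdeg c.1 + 1 = F.hdeg b.1 ∧ e + F.mdeg c.1 = F.mdeg b.1 := by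
    intro b c e he
    change e ∈ (p (F.d (ι (Finsupp.single b 1))) c).support at he
    rw [hιs, hp] at he
    rcases Finset.mem_union.mp (support_sub _ _ _ he) with h | h
    · exact F.d_homogeneous _ _ e h
    -- The correction term is a path from `b` through `c₀` and `b₀` to `c`; it is homogeneous
    -- because `b₀` and `c₀` have the same multidegree.
    · obtain ⟨e1, h1, e2, h2, rfl⟩ := Finset.mem_add.mp (support_mul _ _ h)
      have h1' : e1 ∈ (F.d (Finsupp.single b.1 1) c₀).support := by
        rw [mem_support_iff, coeff_C_mul] at h1
        exact mem_support_iff.mpr (right_ne_zero_of_mul h1)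
      obtain ⟨h3, h4⟩ := F.d_homogeneous _ _ _ h1'
      obtain ⟨h5, h6⟩ := F.d_homogeneous _ _ _ h2
      exact ⟨by omega, by rw [add_assoc, h6, ← hmdeg0, h4]⟩
  have hdd' : (p ∘ₗ F.d ∘ₗ ι) ∘ₗ (p ∘ₗ F.d ∘ₗ ι) = 0 := by
    refine LinearMap.ext fun x => ?_
    simp only [LinearMap.comp_apply, LinearMap.zero_apply]
    obtain ⟨α, hα⟩ := hdecomp (F.d (ι x))
    have h1 := congrArg (fun y => p (F.d y)) hα
    simp only [map_add, map_smul, F.d_d, hpd, smul_zero, add_zero, map_zero] at h1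
    exact h1.symm
  have := F.finite_B
  refine ⟨⟨B', inferInstance, fun b => F.hdeg b.1, fun b => F.mdeg b.1, p ∘ₗ F.d ∘ₗ ι, hd', hdd'⟩,
    ι, p, ?_, fun x => rfl, hpι, hpb, hpd, hdecomp, ?_, ?_, fun b => ⟨b.1, rfl, rfl, hιs b⟩⟩
  · exact Finite.card_subtype_lt (x := b₀) (by simp)
  · intro i x hx
    refine map_mem_of_mem_part (fun b hb => ?_) hx
    rw [hιs, mem_part]
    intro c hc
    rw [Finsupp.single_apply] at hc
    split_ifs at hc with h
    · exact h ▸ hb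
    · exact (hc rfl).elim
  · intro i x hx
    rw [mem_part] at hx ⊢
    intro c hc
    rw [hp] at hc
    by_cases h1 : x c.1 = 0
    · rw [h1, zero_sub, neg_ne_zero] at hc
      have h2 := hx c₀ (right_ne_zero_of_mul (left_ne_zero_of_mul hc))
      have h3 := hdeg_of_d_ne_zero (right_ne_zero_of_mul hc)
      change F.hdeg c.1 = i
      omega
    · exact hx _ h1

/-- By homogeneity, an entry outside the ideal of the variables is a nonzero constant, and
cancelling it drops two basis elements. The projection `p` is a chain map and carries exactness
over; `ι` is not one, so cycles must be corrected before they are lifted. -/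
theorem exists_smaller_resolution (h : F.IsFreeResolution M) (hmin : ¬ F.IsMinimal) :
    ∃ F' : MultigradedComplex n k, F'.IsFreeResolution M ∧ Nat.card F'.B < Nat.card F.B := by
  classical
  have hunit : ∃ b₀ c₀, ∃ l : k, l ≠ 0 ∧ F.d (Finsupp.single b₀ 1) c₀ = C l := by
    simp only [IsMinimal, not_forall] at hmin
    obtain ⟨b, c, hbc⟩ := hmin
    refine ⟨b, c, F.dBar (Finsupp.single b 1) c, ?_, ?_⟩
    · intro h0
      rw [d_single_apply, h0, map_zero] at hbc
      exact hbc (zero_mem _)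
    · rw [d_single_apply] at hbc ⊢
      have h0 : F.mdeg b - F.mdeg c = 0 := by
        by_contra hne
        refine hbc ?_
        rw [← Set.image_univ, mem_ideal_span_X_image]
        intro e he
        obtain ⟨j, hj⟩ := Finsupp.ne_iff.mp hne
        rw [Finset.mem_singleton.mp (support_monomial_subset he)]
        exact ⟨j, Set.mem_univ j, hj⟩
      rw [h0, C_apply]
  obtain ⟨b₀, c₀, l, hl, hbc⟩ := hunit
  obtain ⟨F', ι, p, hcard, hd', hpι, hpb, hpd, hdecomp, hιpart, hppart, hbasis⟩ := exists_cancel hl hbc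
  have hdeg0 : F.hdeg c₀ + 1 = F.hdeg b₀ := hdeg_of_d_ne_zero (by rw [hbc]; simpa using hl)
  obtain ⟨ε, hε0, hεpos, hsurj, hex0, hex⟩ := h
  have hεd : ∀ f, ε (F.d f) = 0 := by
    intro f
    suffices hs : ε ∘ₗ F.d = 0 from LinearMap.congr_fun hs f
    ext1 b; ext1
    simp only [LinearMap.comp_apply, Finsupp.lsingle_apply, LinearMap.zero_apply]
    have hbpart : Finsupp.single b 1 ∈ F.part (F.hdeg b) :=
      Finsupp.single_mem_supported _ _ rfl
    by_cases hb : F.hdeg b = 1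
    · rw [hb] at hbpart
      exact (hex0 _ (d_mem_part rfl hbpart)).2 ⟨_, hbpart, rfl⟩
    · rcases Nat.eq_zero_or_eq_succ_pred (F.hdeg b) with h0 | h0
      · have : F.d (Finsupp.single b 1) = 0 := by
          ext1 c
          by_contra hc
          have := hdeg_of_d_ne_zero hc
          omega
        rw [this, map_zero]
      · have : ε (F.d (Finsupp.single b 1)) ∈ (⊥ : Submodule (MvPolynomial (Fin n) k) _) :=
          map_mem_of_mem_part (fun c hc => hεpos c (by omega)) (d_mem_part h0.symm hbpart)
        exact this
  have hει : ∀ x, ε (ι (p x)) = ε x := by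
    intro x
    obtain ⟨α, hα⟩ := hdecomp x
    conv_rhs => rw [hα]
    rw [map_add, map_add, map_smul, map_smul, hεd, hεpos b₀ (by omega), smul_zero, smul_zero,
      add_zero, add_zero]
  have hd'p : ∀ x, F'.d (p x) = p (F.d x) := by
    intro x
    obtain ⟨α, hα⟩ := hdecomp x
    conv_rhs => rw [hα]
    simp only [map_add, map_smul, F.d_d, hpd, smul_zero, add_zero, hd']
  refine ⟨F', ⟨ε ∘ₗ ι, fun b hb => ?_, fun b hb => ?_, fun q => ?_, fun f hf => ⟨fun h0 => ?_, ?_⟩,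
    fun i hi f hf => ⟨fun h0 => ?_, ?_⟩⟩, hcard⟩
  · obtain ⟨b', h1, h2, h3⟩ := hbasis b
    rw [LinearMap.comp_apply, h3, h2]
    exact hε0 b' (h1 ▸ hb)
  · obtain ⟨b', h1, h2, h3⟩ := hbasis b
    rw [LinearMap.comp_apply, h3]
    exact hεpos b' (h1 ▸ hb)
  · obtain ⟨f, rfl⟩ := hsurj q
    exact ⟨p f, hει f⟩
  · obtain ⟨g, hg, hdg⟩ := (hex0 _ (hιpart 0 f hf)).1 h0
    exact ⟨p g, hppart 1 g hg, by rw [hd'p, hdg, hpι]⟩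
  · rintro ⟨g, -, rfl⟩
    rw [LinearMap.comp_apply, hd', hει, hεd]
  -- For a cycle `f` of `F'`, the boundary of `ι f` need not vanish. It lies in the span of `b₀` and
  -- its boundary, and applying `d` once more kills the coefficient `α`. Hence `ι f - γ b₀` is a
  -- cycle, and `p` sends it to `f`.
  · obtain ⟨α, hα⟩ := hdecomp (F.d (ι f))
    rw [← hd', h0, map_zero, zero_add] at hα
    have hα0 : α = 0 := by
      have h1 := congrArg (fun y => F.d y c₀) hα
      simp only [map_add, map_smul, F.d_d, smul_zero, add_zero, Finsupp.smul_apply, hbc,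
        smul_eq_mul, Finsupp.zero_apply] at h1
      exact (mul_eq_zero.mp h1.symm).resolve_right (by simpa using hl)
    rw [hα0, zero_smul, zero_add] at hα
    set γ := C l⁻¹ * F.d (ι f) c₀ with hγ
    have hmem : ι f - γ • Finsupp.single b₀ 1 ∈ F.part i := by
      refine sub_mem (hιpart i f hf) ?_
      by_cases hγ0 : γ = 0
      · rw [hγ0, zero_smul]; exact zero_mem _
      · refine Submodule.smul_mem _ _ (Finsupp.single_mem_supported _ _ ?_)
        have h1 := mem_part.mp (d_mem_part (Nat.sub_add_cancel hi) (hιpart i f hf)) c₀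
          (right_ne_zero_of_mul hγ0)
        change F.hdeg b₀ = i
        omega
    obtain ⟨g, hg, hdg⟩ := (hex i hi _ hmem).1 (by rw [map_sub, map_smul, ← hα, sub_self])
    refine ⟨p g, hppart _ g hg, ?_⟩
    rw [hd'p, hdg, map_sub, hpι, map_smul, hpb, smul_zero, sub_zero]
  · rintro ⟨g, -, rfl⟩
    exact F'.d_d g

theorem IsFreeResolution.exists_minimal (h : F.IsFreeResolution M) :
    ∃ F' : MultigradedComplex n k, F'.IsMinimalFreeResolution M := by
  induction hN : Nat.card F.B using Nat.strong_induction_on generalizing F with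
  | _ N ih =>
    by_cases hmin : F.IsMinimal
    · exact ⟨F, h, hmin⟩
    · obtain ⟨F', hF', hcard⟩ := exists_smaller_resolution h hmin
      exact ih _ (hN ▸ hcard) hF' rfl

end MultigradedComplex
end MonomialResolution

/-! ### The main theorem -/

theorem mainTheorem3 {n r : ℕ} {k : Type*} [Field k]
    (M : Ideal (MvPolynomial (Fin n) k)) (m : Fin r → (Fin n →₀ ℕ))
    (hM : IsMinimallyGeneratedBy M m)
    (i : ℕ) (hi : 1 ≤ i) (a : lcmLattice m) (ha : (a : Fin n →₀ ℕ) ≠ 0) :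
    (∀ (F : MultigradedComplex n k) (g : F.B → (Finset (Fin r) →₀ k)),
      F.IsMinimalFreeResolution M → IsTaylorBasis m F g →
      ∃ β : Module.Basis {b : F.B // F.hdeg b = i ∧ chainMdeg m (g b) = a} k
          (ReducedHomology k (Delta m a) ((i : ℤ) - 2)),
        ∀ b : {b : F.B // F.hdeg b = i ∧ chainMdeg m (g b) = a},
          ∃ hb : boundary k (g b) ∈ cycles k (Delta m a) ((i : ℤ) - 2),
          β b = Subquotient.mk ⟨boundary k (g b), hb⟩) ∧
    bettiNumber M i a = Module.finrank k (ReducedHomology k (Delta m a) ((i : ℤ) - 2)) := by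
  constructor
  · intro F g hF hg
    obtain ⟨φ, ψ, hF', hT, h, hψφ, hφg⟩ := hg.exists_isHomotopyInverse
    obtain ⟨β, hβ⟩ := exists_basis_reducedHomology hF.2 h i a ha
      (fun b => F.hdeg b = i ∧ chainMdeg m (g b) = a)
      (fun b => by rw [← hφg, h.chainMdeg_eq hψφ])
    refine ⟨β, fun b => ?_⟩
    have := hβ b
    rwa [hφg] at this
  · obtain ⟨rfl, -⟩ := hM
    have hmon := isMonomialIdeal_span (k := k) m
    have hT := isStrandResolution_taylor (k := k) m (mem_exponents_span (k := k) m)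
    have hcount : ∀ F : MultigradedComplex n k,
        F.IsMinimalFreeResolution (Ideal.span (Set.range fun j => monomial (m j) (1 : k))) →
        Nat.card {b : F.B // F.hdeg b = i ∧ F.mdeg b = a} =
          Module.finrank k (ReducedHomology k (Delta m a) ((i : ℤ) - 2)) := by
      intro F hF
      obtain ⟨ε, hε⟩ := hF.1.exists_isStrandResolution hmon
      obtain ⟨φ, ψ, hF', hT', h⟩ :=
        hε.exists_isHomotopyInverse (isUpperSet_exponents _) hT
      obtain ⟨β, -⟩ := exists_basis_reducedHomology hF.2 h i a ha _ (fun b => Iff.rfl)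
      exact (Module.finrank_eq_nat_card_basis β).symm
    obtain ⟨F₀, hF₀⟩ := (hT.isFreeResolution hmon).exists_minimal
    -- The infimum is over a singleton. That the set is nonempty matters, since the infimum of the
    -- empty set would be 0.
    have hset : {q | ∃ F : MultigradedComplex n k, F.IsMinimalFreeResolution
        (Ideal.span (Set.range fun j => monomial (m j) (1 : k))) ∧
        q = Nat.card {b : F.B // F.hdeg b = i ∧ F.mdeg b = a}} =
        {Module.finrank k (ReducedHomology k (Delta m a) ((i : ℤ) - 2))} := by
      ext q
      constructor
      · rintro ⟨F, hF, rfl⟩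
        exact hcount F hF
      · rintro rfl
        exact ⟨F₀, hF₀, (hcount F₀ hF₀).symm⟩
    rw [bettiNumber, hset, csInf_singleton]
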